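/- Let $1<R_2<R_1<R$, write $D_R=\{z\in\mathbb C:|z|<R\}$, $\mathbb T=\mathbb R/\mathbb Z$ with Lebesgue measure $|\cdot|$ of total mass one, and $e(x)=\exp(2\pi i x)$. Put $$B_0=\frac{1}{2\log(R/R_1)}\cdot\frac{R_1+R_2}{R_1-R_2}\cdot\begin{cases}\log R,& R^2-R_1^2>R,\\ \log\frac{R^2}{R^2-R_1^2},& R^2-R_1^2\le R,\end{cases}\qquad B_1=B_0\,\frac{8R_2}{R_2^2-1},$$ $$B_2=B_0\,\frac{16\pi(R_2^2-1)\sqrt{16R_2^2-\big(\sqrt{R_2^4+34R_2^2+1}-1-R_2^2\big)^2}}{\big(3R_2^2+3-\sqrt{R_2^4+34R_2^2+1}\big)^2},\qquad B_3=\sqrt{5B_2+\frac{10\pi}{\log(R/R_1)}}.$$ Let $v:D_R\to\mathbb R\cup\{-\infty\}$ be subharmonic (upper semicontinuous with the sub-mean value property), with $v\le B$ on $D_R$ and $v(0)=m\in\mathbb R$. Suppose that for some $c\in\mathbb R$ $$v(e(x))=v_1(x)+v_0(x)+c\quad\text{for a.e. }x\in\mathbb T,\qquad \|v_1\|_{L^1(\mathbb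 T)}<\varepsilon_1,\quad \|v_0\|_{L^\infty(\mathbb T)}<\varepsilon_0,$$ with $v_1,v_0$ real-valued and measurable, and that $\varepsilon_1\le \frac{B_3^2}{289}(B-m)$. Set $\delta_0=\frac92\varepsilon_0+2B_3\sqrt{\varepsilon_1(B-m)}$. Then $$\int_{\mathbb T}\exp\Big(\frac{\pi}{4}\,\delta_0^{-1}\,|v(e(x))-c|\Big)\,dx\;\le\; C_0:=2\sqrt2\,\exp\Big(\pi\Big[\frac{17}{144}+\frac{B_1}{16B_3^2}\Big]\Big),$$ and for every $\varepsilon_2>0$ $$\big|\{x\in\mathbb T:\ |v(e(x))-c|>\varepsilon_2\}\big|\;\le\;2\sqrt2\,\exp\Big(\frac{\pi}{4}\Big[\frac{17}{144}+\frac{B_1}{16B_3^2}-\varepsilon_2\,\delta_0^{-1}\Big]\Big).$$ -/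

import Mathlib

open MeasureTheory

noncomputable section

/-- `e(x) = exp(2πix)`, as a map from the circle `ℝ/ℤ` to `ℂ`. The measure `volume` on
`UnitAddCircle` is the Lebesgue measure, of total mass one. -/
def expCircle (x : UnitAddCircle) : ℂ := (AddCircle.toCircle x : ℂ)

/-- The integral over the circle `ℝ/ℤ` of a function with values in `[-∞, ∞]`, as the integral of
the positive part minus that of the negative part. For a function that is bounded above, it is the
usual integral with values in `[-∞, ∞)`. -/
def circleMean (f : UnitAddCircle → EReal) : EReal :=
  ((∫⁻ x, (f x).toENNReal : ENNReal) : EReal) - ((∫⁻ x, (-f x).toENNReal : ENNReal) : EReal)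

/-- Subharmonic functions on `Ω ⊆ ℂ`: upper semicontinuous, with values in `ℝ ∪ {-∞}`, and with
the sub-mean value property on every closed disk contained in `Ω`. -/
structure IsSubharmonicOn (v : ℂ → EReal) (Ω : Set ℂ) : Prop where
  ne_top : ∀ z ∈ Ω, v z ≠ ⊤
  upperSemicontinuousOn : UpperSemicontinuousOn v Ω
  le_circleMean : ∀ (z : ℂ) (r : ℝ), 0 < r → Metric.closedBall z r ⊆ Ω →
    v z ≤ circleMean (fun θ => v (z + r * expCircle θ))

/-- The constant `B₀(R, R₁, R₂)`. If `R² - R₁² = R`, both cases give the same value. -/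
def constB0 (R R₁ R₂ : ℝ) : ℝ :=
  1 / (2 * Real.log (R / R₁)) * ((R₁ + R₂) / (R₁ - R₂)) *
    (if R ^ 2 - R₁ ^ 2 > R then Real.log R else Real.log (R ^ 2 / (R ^ 2 - R₁ ^ 2)))

/-- The constant `B₁(R, R₁, R₂)`. -/
def constB1 (R R₁ R₂ : ℝ) : ℝ :=
  constB0 R R₁ R₂ * (8 * R₂ / (R₂ ^ 2 - 1))

/-- The constant `B₂(R, R₁, R₂)`. -/
def constB2 (R R₁ R₂ : ℝ) : ℝ :=
  constB0 R R₁ R₂ *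
    (16 * Real.pi * (R₂ ^ 2 - 1) *
        √(16 * R₂ ^ 2 - (√(R₂ ^ 4 + 34 * R₂ ^ 2 + 1) - 1 - R₂ ^ 2) ^ 2) /
      (3 * R₂ ^ 2 + 3 - √(R₂ ^ 4 + 34 * R₂ ^ 2 + 1)) ^ 2)

/-- The constant `B₃(R, R₁, R₂)`. -/
def constB3 (R R₁ R₂ : ℝ) : ℝ :=
  √(5 * constB2 R R₁ R₂ + 10 * Real.pi / Real.log (R / R₁))

/-- `δ₀ = (9/2) ε₀ + 2 B₃ √(ε₁ (B - m))`. -/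
def delta0 (R R₁ R₂ B m ε₀ ε₁ : ℝ) : ℝ :=
  9 / 2 * ε₀ + 2 * constB3 R R₁ R₂ * √(ε₁ * (B - m))

/-- `C₀ = 2√2 exp(π [17/144 + B₁ / (16 B₃²)])`. -/
def constC0 (R R₁ R₂ : ℝ) : ℝ :=
  2 * √2 *
    Real.exp (Real.pi * (17 / 144 + constB1 R R₁ R₂ / (16 * constB3 R R₁ R₂ ^ 2)))

end

namespace SubharmonicSplitting

open Metric Set Filter Topology Real
open scoped ENNReal

/-! Put `w = B - v`, a nonnegative superharmonic function on the disk of radius `R` with `w 0 = B -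
m`. On the unit circle `w = g` almost everywhere with `g = b - q`, `q = v₁ + v₀`, `b = B - c`. The
proof studies the analytic function `Q` whose real part is the harmonic extension of `q` to the unit
disk, dilated by `s < 1` to be smooth on the circle; at the end `s → 1`.

The superharmonicity of `w` beyond the unit circle bounds the radial derivative of `Re Q` on the
circle from above by a constant (`IsNonnegSuperharmonicOn.neg_le_re_mul_deriv`). This plays the role
of a bound on the Riesz mass. If the bound failed at `z₀`, the extension of `g` inside the disk and
its reflection outside, lowered by a multiple of `log |z|`, would both be minorants of `w` and would
fit together near `z₀` as a maximum. That maximum touches `w` at `z₀` and violates the super-mean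
value property there.

By the Cauchy-Riemann equations the bound says that `-Im Q`, plus a linear term `κ t`, increases
along the circle. A positive density has mass on an arc controlled by its Poisson integral at one
interior point, and there the smallness of `v₁` and `v₀` bounds the derivative of `Q`
(`increment_le`, `norm_mul_integral_le`). Hence `Im Q` differs from its averages over arcs of
half-width `δ` by at most `A`.

Subtracting these arc averages leaves an analytic function vanishing at `0`, with imaginary part at
most `A` on the circle; the mean value property of its `cosh` gives exponential integrability of its
real part (`integral_cosh_le`). The arc averages of `Re Q` are at most `ε₀ + ε₁ / (2δ)`. Taking `δ`
of order `√(ε₁ / κ)` balances the contributions of `κ` and `ε₁`. The resulting integral estimate is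
stronger than the required one, and the measure estimate follows by Markov's inequality. -/

/-! ### The parametrization of the unit circle and circle averages. -/

@[simp] lemma norm_expCircle (x : UnitAddCircle) : ‖expCircle x‖ = 1 :=
  Circle.norm_coe _

lemma expCircle_ne_zero (x : UnitAddCircle) : expCircle x ≠ 0 := by
  simp [expCircle]

@[fun_prop] lemma continuous_expCircle : Continuous expCircle :=
  continuous_subtype_val.comp AddCircle.continuous_toCircle

lemma expCircle_add (x y : UnitAddCircle) : expCircle (x + y) = expCircle x * expCircle y := by
  simp [expCircle, AddCircle.toCircle_add]

@[simp] lemma expCircle_zero : expCircle 0 = 1 := by simp [expCircle]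

lemma expCircle_neg (x : UnitAddCircle) : expCircle (-x) = (expCircle x)⁻¹ := by
  simp [expCircle, AddCircle.toCircle_neg]

lemma expCircle_sub (x y : UnitAddCircle) : expCircle (x - y) = expCircle x / expCircle y := by
  rw [sub_eq_add_neg, expCircle_add, expCircle_neg, div_eq_mul_inv]

lemma expCircle_coe (t : ℝ) : expCircle (t : UnitAddCircle) = Complex.exp (2 * π * t * Complex.I) := by
  simp [expCircle, AddCircle.toCircle_apply_mk, Circle.coe_exp]

lemma exists_expCircle_eq {z : ℂ} (hz : ‖z‖ = 1) : ∃ x, expCircle x = z := by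
  obtain ⟨x, hx⟩ := (AddCircle.homeomorphCircle (T := 1) one_ne_zero).surjective
    ⟨z, mem_sphere_zero_iff_norm.2 hz⟩
  refine ⟨x, ?_⟩
  rw [AddCircle.homeomorphCircle_apply] at hx
  rw [expCircle, hx]

lemma ofReal_integral_le_lintegral_ofReal {f : UnitAddCircle → ℝ} (hf : Integrable f) :
    ENNReal.ofReal (∫ x, f x) ≤ ∫⁻ x, ENNReal.ofReal (f x) := by
  have h := ofReal_integral_eq_lintegral_ofReal hf.pos_part
    (Eventually.of_forall fun x => le_max_right _ _)
  simp only [ENNReal.ofReal_max, ENNReal.ofReal_zero, max_zero] at h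
  rw [← h]
  exact ENNReal.ofReal_le_ofReal (integral_mono hf hf.pos_part fun x => le_max_left _ _)

/-- Integration over `ℝ/ℤ` along `e` is the average over a circle. -/
lemma integral_expCircle_eq_circleAverage {F : Type*} [NormedAddCommGroup F] [NormedSpace ℝ F]
    (f : ℂ → F) (c : ℂ) (r : ℝ) :
    ∫ x, f (c + r * expCircle x) = Real.circleAverage f c r := by
  rw [← UnitAddCircle.intervalIntegral_preimage 0 (fun x => f (c + r * expCircle x)),
    Real.circleAverage_def]
  have h := intervalIntegral.inv_smul_integral_comp_div (a := 0) (b := 2 * π)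
    (fun x : ℝ => f (c + r * expCircle (x : UnitAddCircle))) (2 * π)
  rw [zero_div, div_self (by positivity)] at h
  rw [zero_add, ← h]
  congr 2
  ext x
  rw [expCircle_coe, circleMap]
  congr 4
  push_cast
  field_simp

lemma integral_comp_expCircle {F : Type*} [NormedAddCommGroup F] [NormedSpace ℝ F] (f : ℂ → F) :
    ∫ x, f (expCircle x) = Real.circleAverage f 0 1 := by
  simpa using integral_expCircle_eq_circleAverage f 0 1

lemma circleIntegrable_of_integrable_comp_expCircle {F : Type*} [NormedAddCommGroup F]
    [NormedSpace ℝ F] {f : ℂ → F} (h : Integrable (fun x => f (expCircle x))) :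
    CircleIntegrable f 0 1 := by
  have h1 : IntegrableOn (fun x : ℝ => f (expCircle (x : UnitAddCircle))) (Ioc 0 (0 + 1)) :=
    ((UnitAddCircle.measurePreserving_mk 0).integrable_comp_of_integrable h)
  have h2 : IntervalIntegrable (fun x : ℝ => f (expCircle (x : UnitAddCircle))) volume 0 1 := by
    rw [intervalIntegrable_iff_integrableOn_Ioc_of_le zero_le_one]
    simpa using h1
  have h3 := h2.comp_mul_right (c := (2 * π)⁻¹)
  rw [CircleIntegrable]
  convert h3 using 1
  · ext x
    rw [expCircle_coe, circleMap]
    congr 2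
    push_cast
    field_simp
    simp
  · simp
  · simp

/-! ### Nonnegative superharmonic functions and their rotation averages. -/

/-- Superharmonic functions on `Ω` with values in `[0, ∞]`, extended to `ℂ` in a lower
semicontinuous way. -/
structure IsNonnegSuperharmonicOn (w : ℂ → ℝ≥0∞) (Ω : Set ℂ) : Prop where
  lsc : LowerSemicontinuous w
  lintegral_le : ∀ (z : ℂ) (r : ℝ), 0 < r → closedBall z r ⊆ Ω →
    ∫⁻ θ, w (z + r * expCircle θ) ≤ w z

lemma add_mul_expCircle_mem_closedBall (z : ℂ) {r : ℝ} (hr : 0 ≤ r) (θ : UnitAddCircle) :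
    z + r * expCircle θ ∈ closedBall z r := by
  simp [mem_closedBall, dist_eq_norm, abs_of_nonneg hr]

/-- This is `B = v + (B - v)` with all negative parts moved across, so that it can be integrated
term by term without subtracting infinite quantities. -/
lemma sub_toENNReal_add (B v : EReal) (h : v ≤ B) (hB : B ≠ ⊤) (hB' : B ≠ ⊥) :
    B.toENNReal + (-v).toENNReal = (-B).toENNReal + v.toENNReal + (B - v).toENNReal := by
  lift B to ℝ using ⟨hB, hB'⟩
  induction v with
  | bot => simp
  | top => simp at h
  | coe v =>
    have h' : v ≤ B := by exact_mod_cast h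
    rw [← EReal.coe_neg, ← EReal.coe_neg, ← EReal.coe_sub]
    simp only [EReal.toENNReal_of_ne_top (EReal.coe_ne_top _), EReal.toReal_coe]
    rcases le_total 0 B with hb | hb <;> rcases le_total 0 v with hv | hv
    · rw [ENNReal.ofReal_of_nonpos (p := -v) (by linarith),
        ENNReal.ofReal_of_nonpos (p := -B) (by linarith), zero_add, add_zero,
        ← ENNReal.ofReal_add hv (by linarith)]
      congr 1; ring
    · rw [ENNReal.ofReal_of_nonpos (p := v) (by linarith),
        ENNReal.ofReal_of_nonpos (p := -B) (by linarith), zero_add, zero_add,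
        ← ENNReal.ofReal_add hb (by linarith)]
      congr 1
    · obtain rfl : B = 0 := by linarith
      obtain rfl : v = 0 := by linarith
      simp
    · rw [ENNReal.ofReal_of_nonpos (p := v) (by linarith),
        ENNReal.ofReal_of_nonpos (p := B) (by linarith), zero_add, add_zero,
        ← ENNReal.ofReal_add (by linarith) (by linarith)]
      congr 1; ring

/-- The nonnegative superharmonic function `B - v`. -/
noncomputable def superharmonicGap (v : ℂ → EReal) (B : ℝ) (Ω : Set ℂ) : ℂ → ℝ≥0∞ :=
  Ω.indicator (fun z => ((B : EReal) - v z).toENNReal)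

/-- Extending by `0`, the least possible value, outside an open set preserves lower semicontinuity.
For the mean value inequality, positive and negative parts are integrated separately; boundedness
above makes the positive part of `v` integrable. -/
lemma isNonnegSuperharmonicOn_superharmonicGap {v : ℂ → EReal} {Ω : Set ℂ} (hΩ : IsOpen Ω)
    (hv : IsSubharmonicOn v Ω) {B : ℝ} (hB : ∀ z ∈ Ω, v z ≤ (B : EReal)) :
    IsNonnegSuperharmonicOn (superharmonicGap v B Ω) Ω := by
  have hcont : Continuous (fun t : EReal => ((B : EReal) - t).toENNReal) := by
    refine EReal.continuous_toENNReal.comp ?_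
    rw [continuous_iff_continuousAt]
    intro t
    have : ContinuousAt (fun p : EReal × EReal => p.1 + p.2) ((B : EReal), -t) :=
      EReal.continuousAt_add (Or.inl (EReal.coe_ne_top _)) (Or.inl (EReal.coe_ne_bot _))
    exact this.comp (f := fun t : EReal => ((B : EReal), -t))
      (by exact (continuous_const.prodMk continuous_neg).continuousAt)
  have hanti : Antitone (fun t : EReal => ((B : EReal) - t).toENNReal) := by
    intro a b hab
    exact EReal.toENNReal_le_toENNReal (EReal.sub_le_sub le_rfl hab)
  refine ⟨?_, ?_⟩
  · intro z y hy
    by_cases hz : z ∈ Ω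
    · have h1 : UpperSemicontinuousAt v z :=
        fun y hy => by simpa [hΩ.nhdsWithin_eq hz] using hv.upperSemicontinuousOn z hz y hy
      have h2 : LowerSemicontinuousAt (fun z => ((B : EReal) - v z).toENNReal) z :=
        hcont.continuousAt.comp_upperSemicontinuousAt_antitone h1 hanti
      rw [superharmonicGap, indicator_of_mem hz] at hy
      filter_upwards [h2 y hy, hΩ.mem_nhds hz] with x hx hxΩ
      rwa [superharmonicGap, indicator_of_mem hxΩ]
    · rw [superharmonicGap, indicator_of_notMem hz] at hy
      simp at hy
  · intro z r hr hsub
    have hz : z ∈ Ω := hsub (mem_closedBall_self hr.le)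
    have hmem : ∀ θ, z + r * expCircle θ ∈ Ω := fun θ =>
      hsub (add_mul_expCircle_mem_closedBall z hr.le θ)
    have husc : UpperSemicontinuous (fun θ => v (z + r * expCircle θ)) := by
      intro θ
      have h1 : UpperSemicontinuousAt v (z + r * expCircle θ) :=
        fun y hy => by
          simpa [hΩ.nhdsWithin_eq (hmem θ)] using hv.upperSemicontinuousOn _ (hmem θ) y hy
      have h2 : ContinuousAt (fun θ => z + r * expCircle θ) θ := by fun_prop
      exact fun y hy => h2.eventually (h1 y hy)
    have hmeas : Measurable (fun θ => v (z + r * expCircle θ)) := husc.measurable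
    have hle := hv.le_circleMean z r hr hsub
    have key : ∀ x ∈ Ω, (B : EReal).toENNReal + (-v x).toENNReal =
        (-(B : EReal)).toENNReal + (v x).toENNReal + superharmonicGap v B Ω x := fun x hx => by
      rw [superharmonicGap, indicator_of_mem hx]
      exact sub_toENNReal_add _ _ (hB x hx) (EReal.coe_ne_top _) (EReal.coe_ne_bot _)
    have hI : (B : EReal).toENNReal + ∫⁻ θ, (-v (z + r * expCircle θ)).toENNReal =
        (-(B : EReal)).toENNReal + (∫⁻ θ, (v (z + r * expCircle θ)).toENNReal) +
          ∫⁻ θ, superharmonicGap v B Ω (z + r * expCircle θ) := by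
      have h1 : ∫⁻ θ, ((B : EReal).toENNReal + (-v (z + r * expCircle θ)).toENNReal) =
        ∫⁻ θ, ((-(B : EReal)).toENNReal + (v (z + r * expCircle θ)).toENNReal +
          superharmonicGap v B Ω (z + r * expCircle θ)) :=
        lintegral_congr fun θ => key _ (hmem θ)
      rw [lintegral_add_left measurable_const, lintegral_add_left (f := fun θ =>
          (-(B : EReal)).toENNReal + (v (z + r * expCircle θ)).toENNReal)
          (measurable_const.add hmeas.ereal_toENNReal),
        lintegral_add_left measurable_const] at h1
      simpa using h1
    have hfin : ∫⁻ θ, (v (z + r * expCircle θ)).toENNReal ≠ ⊤ := by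
      refine ne_top_of_le_ne_top (b := (B : EReal).toENNReal) (by simp) ?_
      calc _ ≤ ∫⁻ _ : UnitAddCircle, (B : EReal).toENNReal :=
            lintegral_mono fun θ => EReal.toENNReal_le_toENNReal (hB _ (hmem θ))
        _ = _ := by simp
    rw [circleMean] at hle
    rw [show superharmonicGap v B Ω z = ((B : EReal) - v z).toENNReal from indicator_of_mem hz _]
    generalize (∫⁻ θ, (v (z + r * expCircle θ)).toENNReal) = a at *
    generalize (∫⁻ θ, (-v (z + r * expCircle θ)).toENNReal) = b at *
    generalize (∫⁻ θ, superharmonicGap v B Ω (z + r * expCircle θ)) = J at *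
    generalize v z = u at *
    lift a to NNReal using hfin
    -- If the negative part of `v` has infinite integral, the sub-mean value property forces `v z =
    -- -∞`, so the gap at `z` is infinite and nothing remains to prove.
    induction b with
    | top =>
      have : u = ⊥ := by simpa using hle
      simp [this]
    | coe b =>
      have hJ : J ≠ ⊤ := by
        rintro rfl
        simp [ENNReal.add_eq_top] at hI
      lift J to NNReal using hJ
      have hI' := congrArg ENNReal.toReal hI
      rw [ENNReal.toReal_add (by simp) (by simp), ENNReal.toReal_add (by simp) (by simp),
        ENNReal.toReal_add (by simp) (by simp)] at hI'
      rw [← EReal.coe_neg] at hI'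
      simp only [EReal.toENNReal_of_ne_top (EReal.coe_ne_top _), EReal.toReal_coe,
        ENNReal.toReal_ofReal', ENNReal.coe_toReal] at hI'
      have hB2 : max B 0 - max (-B) 0 = B := by
        rcases le_total 0 B with h | h
        · rw [max_eq_left h, max_eq_right (by linarith)]; ring
        · rw [max_eq_right h, max_eq_left (by linarith)]; ring
      induction u with
      | bot => simp
      | top =>
        have : ((a : ENNReal) : EReal) - ((b : ENNReal) : EReal) = (((a : ℝ) - b : ℝ) : EReal) := by
          rw [EReal.coe_sub]; rfl
        rw [this] at hle
        exact absurd hle (not_le.2 (EReal.coe_lt_top _))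
      | coe u =>
        have : ((a : ENNReal) : EReal) - ((b : ENNReal) : EReal) = (((a : ℝ) - b : ℝ) : EReal) := by
          rw [EReal.coe_sub]; rfl
        rw [this] at hle
        have hle' : u ≤ (a : ℝ) - b := by exact_mod_cast hle
        rw [← EReal.coe_sub, EReal.toENNReal_of_ne_top (EReal.coe_ne_top _), EReal.toReal_coe]
        refine ENNReal.le_ofReal_iff_toReal_le (by simp) ?_ |>.2 ?_
        · have := J.coe_nonneg; linarith
        · simp only [ENNReal.coe_toReal]; linarith

lemma IsNonnegSuperharmonicOn.measurable_comp {w : ℂ → ℝ≥0∞} {Ω : Set ℂ}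
    (hw : IsNonnegSuperharmonicOn w Ω) {X : Type*} [TopologicalSpace X] [MeasurableSpace X]
    [OpensMeasurableSpace X] {g : X → ℂ} (hg : Continuous g) : Measurable (fun x => w (g x)) := by
  have : LowerSemicontinuous (fun x => w (g x)) := fun x y hy =>
    hg.continuousAt.eventually (hw.lsc (g x) y hy)
  exact this.measurable

/-- Averages of rotations of `w` with respect to the density `p`. -/
noncomputable def rotationAverage (w : ℂ → ℝ≥0∞) (p : UnitAddCircle → ℝ≥0∞) (z : ℂ) : ℝ≥0∞ :=
  ∫⁻ y, w (z * expCircle y) * p y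

/-- Lower semicontinuity is Fatou's lemma; the mean value inequality is Tonelli's theorem, since a
rotation about `0` preserves the disk and carries circles to circles of equal radius. With a Poisson
kernel as `p`, this replaces the boundary values of `w` by smooth ones while keeping
superharmonicity on the whole disk. -/
lemma IsNonnegSuperharmonicOn.rotationAverage {w : ℂ → ℝ≥0∞} {R : ℝ}
    (hw : IsNonnegSuperharmonicOn w (ball 0 R)) {p : UnitAddCircle → ℝ≥0∞} (hp : Measurable p) :
    IsNonnegSuperharmonicOn (rotationAverage w p) (ball 0 R) := by
  have hm : ∀ z, Measurable fun y => w (z * expCircle y) * p y := fun z =>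
    (hw.measurable_comp (by fun_prop)).mul hp
  refine ⟨?_, ?_⟩
  · intro z y hy
    by_contra hcon
    rw [not_eventually] at hcon
    obtain ⟨u, hu, huy⟩ := exists_seq_forall_of_frequently hcon
    have h1 : SubharmonicSplitting.rotationAverage w p z ≤
        liminf (fun n => SubharmonicSplitting.rotationAverage w p (u n)) atTop := by
      refine le_trans (lintegral_mono fun x => ?_) (lintegral_liminf_le fun n => hm (u n))
      have h2 : Tendsto (fun n => u n * expCircle x) atTop (𝓝 (z * expCircle x)) :=
        hu.mul_const _
      have h3 : w (z * expCircle x) ≤ liminf (fun n => w (u n * expCircle x)) atTop :=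
        ((lowerSemicontinuousAt_iff_le_liminf.1 (hw.lsc (z * expCircle x)))).trans
          (h2.liminf_le_liminf_comp)
      calc w (z * expCircle x) * p x
          ≤ liminf (fun n => w (u n * expCircle x)) atTop * liminf (fun _ : ℕ => p x) atTop := by
            gcongr
            simp
        _ ≤ _ := ENNReal.le_liminf_mul
    have h4 : liminf (fun n => SubharmonicSplitting.rotationAverage w p (u n)) atTop ≤ y :=
      liminf_le_of_frequently_le' (Frequently.of_forall fun n => not_lt.1 (huy n))
    exact absurd (h1.trans h4) (not_le.2 hy)
  · intro z r hr hsub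
    simp only [SubharmonicSplitting.rotationAverage]
    rw [lintegral_lintegral_swap]
    · refine lintegral_mono fun y => ?_
      rw [lintegral_mul_const _ (hw.measurable_comp (by fun_prop))]
      gcongr
      have h1 : ∫⁻ θ, w ((z + r * expCircle θ) * expCircle y) =
          ∫⁻ θ, w (z * expCircle y + r * expCircle θ) := by
        rw [← lintegral_add_right_eq_self (fun θ => w (z * expCircle y + r * expCircle θ)) y]
        refine lintegral_congr fun θ => ?_
        rw [expCircle_add]
        congr 1; ring
      rw [h1]
      refine hw.lintegral_le _ r hr fun x hx => ?_
      have h2 : x / expCircle y ∈ closedBall z r := by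
        rw [mem_closedBall, dist_eq_norm] at hx ⊢
        rw [show x / expCircle y - z = (x - z * expCircle y) / expCircle y by
          field_simp [expCircle_ne_zero y], norm_div, norm_expCircle, div_one]
        exact hx
      have h3 := hsub h2
      rw [mem_ball_zero_iff] at h3 ⊢
      rwa [norm_div, norm_expCircle, div_one] at h3
    · refine Measurable.aemeasurable ?_
      exact (hw.measurable_comp (X := UnitAddCircle × UnitAddCircle)
        (g := fun q => (z + r * expCircle q.1) * expCircle q.2) (by fun_prop)).mul
          (hp.comp measurable_snd)

/-! ### The minimum principle and a one-sided bound for the radial derivative. -/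

lemma integral_expCircle_of_harmonic {U : ℂ → ℝ} {z : ℂ} {r : ℝ} (hr : 0 ≤ r)
    (hU : InnerProductSpace.HarmonicOnNhd U (closedBall z r)) :
    ∫ θ, U (z + r * expCircle θ) = U z := by
  rw [integral_expCircle_eq_circleAverage,
    InnerProductSpace.HarmonicOnNhd.circleAverage_eq (by rwa [abs_of_nonneg hr])]

lemma continuous_comp_add_mul_expCircle {X : Type*} [TopologicalSpace X] {U : ℂ → X} {z : ℂ}
    {r : ℝ} (hr : 0 ≤ r) (hU : ContinuousOn U (closedBall z r)) :
    Continuous (fun θ => U (z + r * expCircle θ)) :=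
  hU.comp_continuous (by fun_prop) (add_mul_expCircle_mem_closedBall z hr)

lemma Continuous.integrable_circle {f : UnitAddCircle → ℝ} (hf : Continuous f) : Integrable f :=
  hf.integrable_of_hasCompactSupport (HasCompactSupport.of_compactSpace f)

/-- The minimum principle. -/
lemma IsNonnegSuperharmonicOn.ofReal_le {w : ℂ → ℝ≥0∞} {D : Set ℂ}
    (hw : IsNonnegSuperharmonicOn w D) {K Ω : Set ℂ} (hK : IsCompact K) (hΩ : IsOpen Ω)
    (hΩK : Ω ⊆ K) (hKD : K ⊆ D) {U : ℂ → ℝ} (hU : ContinuousOn U K)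
    (hUΩ : InnerProductSpace.HarmonicOnNhd U Ω)
    (hbd : ∀ z ∈ K \ Ω, ENNReal.ofReal (U z) ≤ w z) :
    ∀ z ∈ K, ENNReal.ofReal (U z) ≤ w z := by
  intro z₁ hz₁
  by_contra hcon
  rw [not_le] at hcon
  obtain ⟨M, hM⟩ := hK.bddAbove_image hU
  have hM : ∀ z ∈ K, U z ≤ M := fun z hz => hM (mem_image_of_mem U hz)
  -- The difference `w - U`, shifted by the upper bound `M` of `U` so that it makes sense in `[0,
  -- ∞]`. A counterexample to the claim means that its minimum over `K` is below `M`.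
  set g : ℂ → ℝ≥0∞ := fun z => w z + ENNReal.ofReal (M - U z) with hg
  have hglsc : LowerSemicontinuousOn g K := by
    refine (hw.lsc.lowerSemicontinuousOn K).add ?_
    exact (ENNReal.continuous_ofReal.comp_continuousOn
      (continuousOn_const.sub hU)).lowerSemicontinuousOn
  obtain ⟨z₀, hz₀, hmin⟩ := hglsc.exists_isMinOn ⟨z₁, hz₁⟩ hK
  have hU1 : 0 < U z₁ := by
    by_contra h
    rw [ENNReal.ofReal_of_nonpos (not_lt.1 h)] at hcon
    simp at hcon
  have hτM : g z₀ < ENNReal.ofReal M := by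
    refine lt_of_le_of_lt (hmin hz₁) ?_
    calc g z₁ < ENNReal.ofReal (U z₁) + ENNReal.ofReal (M - U z₁) :=
          ENNReal.add_lt_add_right ENNReal.ofReal_ne_top hcon
      _ = ENNReal.ofReal M := by
          rw [← ENNReal.ofReal_add hU1.le (sub_nonneg.2 (hM _ hz₁))]
          congr 1; ring
  have hτ : g z₀ ≠ ⊤ := (hτM.trans ENNReal.ofReal_lt_top).ne
  have hZ : IsCompact (K ∩ g ⁻¹' Iic (g z₀)) := hglsc.isCompact_inter_preimage_Iic hK _
  -- Among the minimizers, take one with largest real part. It cannot lie in `K \ Ω`, where `g ≥ M`.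
  -- The mean value inequality makes `g` equal to its minimum almost everywhere on a small circle
  -- about it.
  obtain ⟨z, ⟨hzK, hzτ⟩, hzmax⟩ := hZ.exists_isMaxOn ⟨z₀, hz₀, le_refl (g z₀)⟩
    Complex.continuous_re.continuousOn
  have hzτ' : g z ≤ g z₀ := hzτ
  have hzΩ : z ∈ Ω := by
    by_contra h
    have h1 := hbd z ⟨hzK, h⟩
    have h2 : ENNReal.ofReal M ≤ g z := by
      calc ENNReal.ofReal M = ENNReal.ofReal (U z + (M - U z)) := by congr 1; ring
        _ ≤ ENNReal.ofReal (U z) + ENNReal.ofReal (M - U z) := ENNReal.ofReal_add_le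
        _ ≤ g z := by simp only [hg]; gcongr
    exact absurd (hτM.trans_le (h2.trans hzτ')) (lt_irrefl _)
  obtain ⟨r, hr, hrΩ⟩ := nhds_basis_closedBall.mem_iff.1 (hΩ.mem_nhds hzΩ)
  have hmem : ∀ θ, z + r * expCircle θ ∈ K := fun θ =>
    hΩK (hrΩ (add_mul_expCircle_mem_closedBall z hr.le θ))
  have hUc : Continuous fun θ => U (z + r * expCircle θ) :=
    continuous_comp_add_mul_expCircle hr.le (hU.mono (hrΩ.trans hΩK))
  have hmeas : Measurable fun θ => w (z + r * expCircle θ) := hw.measurable_comp (by fun_prop)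
  have hint : ∫⁻ θ, g (z + r * expCircle θ) ≤ g z₀ := by
    refine le_trans ?_ hzτ'
    simp only [hg]
    rw [lintegral_add_left hmeas]
    gcongr
    · exact hw.lintegral_le z r hr (hrΩ.trans (hΩK.trans hKD))
    · rw [← ofReal_integral_eq_lintegral_ofReal]
      · rw [integral_sub (integrable_const _) (Continuous.integrable_circle hUc),
          integral_expCircle_of_harmonic hr.le (hUΩ.mono hrΩ)]
        simp [measureReal_def]
      · exact Continuous.integrable_circle (continuous_const.sub hUc)
      · exact Eventually.of_forall fun θ => sub_nonneg.2 (hM _ (hmem θ))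
  have hae : (fun _ : UnitAddCircle => g z₀) =ᵐ[volume] fun θ => g (z + r * expCircle θ) := by
    refine ae_eq_of_ae_le_of_lintegral_le (Eventually.of_forall fun θ => hmin (hmem θ)) ?_ ?_ ?_
    · simpa using hτ
    · exact (hmeas.add (ENNReal.continuous_ofReal.comp
        (continuous_const.sub hUc)).measurable).aemeasurable
    · simpa using hint
  have hlsc : LowerSemicontinuous fun θ => g (z + r * expCircle θ) := by
    refine LowerSemicontinuous.add (fun θ y hy => ?_) ?_
    · have h2 : ContinuousAt (fun θ => z + r * expCircle θ) θ := by fun_prop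
      exact h2.eventually (hw.lsc _ y hy)
    · exact (ENNReal.continuous_ofReal.comp (continuous_const.sub hUc)).lowerSemicontinuous
  -- Lower semicontinuity upgrades the almost everywhere equality to the rightmost point of the
  -- circle, a minimizer with larger real part.
  have hzr : g (z + r * expCircle 0) ≤ g z₀ := by
    by_contra h
    have hopen : IsOpen {θ | g z₀ < g (z + r * expCircle θ)} := hlsc.isOpen_preimage _
    have hpos := hopen.measure_pos volume ⟨0, not_le.1 h⟩
    have : volume {θ | g z₀ < g (z + r * expCircle θ)} = 0 := by
      refine measure_mono_null (fun θ hθ => ?_) hae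
      exact ne_of_lt hθ
    exact hpos.ne' this
  have := hzmax ⟨hmem 0, hzr⟩
  simp at this
  linarith

/-- The reflection of `Re Q` in the unit circle, corrected by a multiple of `log |z|`. -/
noncomputable def reflectedRe (Q : ℂ → ℂ) (c : ℝ) (z : ℂ) : ℝ :=
  (Q ((starRingEnd ℂ) z)⁻¹).re - c * Real.log ‖z‖

/-- Conjugating `Q` on both sides gives a holomorphic function; composed with inversion it has real
part `Re Q(1 / conj z)`. The correction `log |z|` is harmonic away from `0`. -/
lemma harmonicAt_reflectedRe {Q : ℂ → ℂ} {σ : ℝ} (hσ : 0 < σ) (hQ : DifferentiableOn ℂ Q (ball 0 σ))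
    (c : ℝ) {z : ℂ} (hz : σ⁻¹ < ‖z‖) : InnerProductSpace.HarmonicAt (reflectedRe Q c) z := by
  have hz0 : ∀ x : ℂ, σ⁻¹ < ‖x‖ → x ≠ 0 := by
    rintro x hx rfl
    rw [norm_zero] at hx
    exact absurd hx (not_lt.2 (by positivity))
  have hopen : IsOpen {x : ℂ | σ⁻¹ < ‖x‖} := isOpen_lt continuous_const continuous_norm
  have h1 : DifferentiableOn ℂ (fun x => (starRingEnd ℂ) (Q ((starRingEnd ℂ) x⁻¹)))
      {x : ℂ | σ⁻¹ < ‖x‖} := by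
    intro x hx
    refine DifferentiableAt.differentiableWithinAt ?_
    have h2 : DifferentiableAt ℂ Q ((starRingEnd ℂ) x⁻¹) := by
      refine hQ.differentiableAt (isOpen_ball.mem_nhds ?_)
      rw [mem_ball_zero_iff, Complex.norm_conj, norm_inv]
      exact inv_lt_of_inv_lt₀ hσ hx
    have h3 : DifferentiableAt ℂ ((starRingEnd ℂ) ∘ Q ∘ (starRingEnd ℂ)) x⁻¹ := by
      exact differentiableAt_conj_conj_iff.2 h2
    exact h3.comp (f := fun x : ℂ => x⁻¹) x (differentiableAt_inv (hz0 x hx))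
  have h2 := (h1.analyticAt (hopen.mem_nhds hz)).harmonicAt_re
  have h3 := (analyticAt_id (𝕜 := ℂ) (z := z)).harmonicAt_log_norm (hz0 z hz)
  have h4 := h2.sub (h3.const_smul (c := c))
  convert h4 using 1
  ext x
  simp [reflectedRe, map_inv₀]

lemma reflectedRe_mul {Q : ℂ → ℂ} {c t : ℝ} {u : ℂ} (ht : 0 < t) (hu : ‖u‖ = 1) :
    reflectedRe Q c (t * u) = (Q (u / t)).re - c * Real.log t := by
  have h : ((starRingEnd ℂ) (t * u))⁻¹ = u / t := by
    rw [map_mul, Complex.conj_ofReal, mul_inv, ← Complex.inv_eq_conj hu, inv_inv]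
    field_simp
  rw [reflectedRe, h, norm_mul, hu, mul_one, Complex.norm_real, Real.norm_of_nonneg ht.le]

/-- Near a point of the unit circle at which the normal derivatives are ordered, the reflected
function exceeds `Re Q` outside the disk and is at most `Re Q` inside. -/
lemma eventually_reflectedRe_sub_sign {Q : ℂ → ℂ} {σ c : ℝ} (hσ : 1 < σ)
    (hQ : DifferentiableOn ℂ Q (ball 0 σ)) {z₀ : ℂ} (hz₀ : ‖z₀‖ = 1)
    (hlt : (z₀ * deriv Q z₀).re < -c / 2) :
    ∀ᶠ z in 𝓝 z₀, (1 < ‖z‖ → (Q z).re < reflectedRe Q c z) ∧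
      (‖z‖ ≤ 1 → reflectedRe Q c z ≤ (Q z).re) := by
  -- `k (τ, u)` is the derivative in `τ` of the reflected function minus `Re Q` at `τ u`. At `(1,
  -- z₀)` it equals `-2 Re (z₀ Q'(z₀)) - c > 0`, and joint continuity keeps it positive for all
  -- directions `u` near `z₀`.
  set k : ℝ × ℂ → ℝ := fun p => -(deriv Q (p.2 / p.1) * (p.2 / p.1 ^ 2)).re
    - (deriv Q (p.1 * p.2) * p.2).re - c / p.1 with hk
  have hQ' : ContinuousAt (deriv Q) z₀ :=
    ((hQ.deriv isOpen_ball).continuousOn).continuousAt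
      (isOpen_ball.mem_nhds (by rw [mem_ball_zero_iff, hz₀]; exact hσ))
  have hkc : ContinuousAt k (1, z₀) := by
    have h1 : ContinuousAt (fun p : ℝ × ℂ => p.2 / p.1) (1, z₀) :=
      ContinuousAt.div (by fun_prop) (by fun_prop) (by simp)
    have h2 : ContinuousAt (fun p : ℝ × ℂ => p.2 / (p.1 : ℂ) ^ 2) (1, z₀) :=
      ContinuousAt.div (by fun_prop) (by fun_prop) (by simp)
    have h3 : ContinuousAt (fun p : ℝ × ℂ => deriv Q (p.2 / p.1)) (1, z₀) :=
      ContinuousAt.comp (f := fun p : ℝ × ℂ => p.2 / p.1) (g := deriv Q) (by simpa using hQ') h1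
    have h4 : ContinuousAt (fun p : ℝ × ℂ => deriv Q (p.1 * p.2)) (1, z₀) :=
      ContinuousAt.comp (f := fun p : ℝ × ℂ => (p.1 : ℂ) * p.2) (g := deriv Q)
        (by simpa using hQ') (by fun_prop)
    have h5 : ContinuousAt (fun p : ℝ × ℂ => c / p.1) (1, z₀) :=
      ContinuousAt.div (by fun_prop) (by fun_prop) (by simp)
    exact (((Complex.continuous_re.continuousAt.comp (h3.mul h2)).neg).sub
      (Complex.continuous_re.continuousAt.comp (h4.mul continuousAt_snd))).sub h5
  have hkpos : 0 < k (1, z₀) := by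
    simp only [hk, Complex.ofReal_one, div_one, one_pow, one_mul]
    rw [mul_comm z₀] at hlt
    linarith
  have hd1 : ContinuousAt (fun p : ℝ × ℂ => ‖p.2 / p.1‖) (1, z₀) :=
    (ContinuousAt.div (by fun_prop) (by fun_prop) (by simp)).norm
  have hd2 : ContinuousAt (fun p : ℝ × ℂ => ‖(p.1 : ℂ) * p.2‖) (1, z₀) := by fun_prop
  have hd3 : ContinuousAt (fun p : ℝ × ℂ => p.1) (1, z₀) := by fun_prop
  have hev := (hkc.eventually (lt_mem_nhds hkpos)).and
    ((hd1.eventually (gt_mem_nhds (a := σ) (by simpa [hz₀] using hσ))).and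
    ((hd2.eventually (gt_mem_nhds (a := σ) (by simpa [hz₀] using hσ))).and
      (hd3.eventually (lt_mem_nhds (a := 0) one_pos))))
  rw [nhds_prod_eq] at hev
  obtain ⟨s, hs, t, ht, hst⟩ := Filter.eventually_prod_iff.1 hev
  obtain ⟨η, hη, hηs⟩ := Metric.eventually_nhds_iff_ball.1 hs
  have hz₀0 : z₀ ≠ 0 := by rintro rfl; simp at hz₀
  have hn1 : ∀ᶠ z in 𝓝 z₀, ‖z‖ ∈ ball (1 : ℝ) η :=
    continuous_norm.continuousAt.eventually (by simp only [hz₀]; exact ball_mem_nhds (1 : ℝ) hη)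
  have hn2 : ∀ᶠ z in 𝓝 z₀, t (z / ‖z‖) := by
    have h1 : ContinuousAt (fun z : ℂ => z / ‖z‖) z₀ :=
      ContinuousAt.div (by fun_prop) (by fun_prop) (by simpa using hz₀0)
    exact h1.eventually (by simpa [hz₀] using ht)
  filter_upwards [hn1, hn2, isOpen_ne.mem_nhds hz₀0] with z hz1 hz2 hz0
  set u := z / ‖z‖ with hu
  have hzn : 0 < ‖z‖ := norm_pos_iff.2 hz0
  have hu1 : ‖u‖ = 1 := by rw [hu, norm_div, Complex.norm_real, norm_norm, div_self hzn.ne']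
  have hzu : z = (‖z‖ : ℝ) * u := by
    rw [hu]; field_simp [(Complex.ofReal_ne_zero.2 hzn.ne')]
  set φ : ℝ → ℝ := fun τ => ((Q (u / τ)).re - c * Real.log τ) - (Q (τ * u)).re with hφ
  have hder : ∀ τ ∈ ball (1 : ℝ) η, HasDerivAt φ (k (τ, u)) τ := by
    intro τ hτ
    obtain ⟨-, h2, h3, h4⟩ := hst (hηs τ hτ) hz2
    simp only at h2 h3 h4
    have hτ0 : (τ : ℂ) ≠ 0 := Complex.ofReal_ne_zero.2 h4.ne'
    have e1 : HasDerivAt Q (deriv Q (u / τ)) (u / τ) :=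
      (hQ.differentiableAt (isOpen_ball.mem_nhds (by rwa [mem_ball_zero_iff]))).hasDerivAt
    have e2 : HasDerivAt Q (deriv Q (τ * u)) (τ * u) :=
      (hQ.differentiableAt (isOpen_ball.mem_nhds (by rwa [mem_ball_zero_iff]))).hasDerivAt
    have e3 : HasDerivAt (fun x : ℂ => Q (u / x)) (deriv Q (u / τ) * (-u / (τ : ℂ) ^ 2)) τ := by
      refine HasDerivAt.comp (h₂ := Q) (h := fun x : ℂ => u / x) (τ : ℂ) e1 ?_
      simpa using (hasDerivAt_const (τ : ℂ) u).fun_div (hasDerivAt_id' (τ : ℂ)) hτ0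
    have e4 : HasDerivAt (fun x : ℂ => Q (x * u)) (deriv Q (τ * u) * u) τ := by
      refine HasDerivAt.comp (h₂ := Q) (h := fun x : ℂ => x * u) (τ : ℂ) e2 ?_
      simpa using (hasDerivAt_id (τ : ℂ)).mul_const u
    have e5 := ((Real.hasDerivAt_log h4.ne').const_mul c)
    have e6 := (e3.real_of_complex.sub e5).sub e4.real_of_complex
    have e7 : k (τ, u) = (deriv Q (u / τ) * (-u / (τ : ℂ) ^ 2)).re - c * τ⁻¹ -
        (deriv Q (τ * u) * u).re := by
      simp only [hk]
      rw [neg_div, mul_neg, Complex.neg_re, div_eq_mul_inv c τ]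
      ring
    rw [e7]
    exact e6
  have hmono : StrictMonoOn φ (ball (1 : ℝ) η) := by
    refine strictMonoOn_of_deriv_pos (convex_ball 1 η)
      (fun τ hτ => (hder τ hτ).continuousAt.continuousWithinAt) fun τ hτ => ?_
    rw [isOpen_ball.interior_eq] at hτ
    rw [(hder τ hτ).deriv]
    exact (hst (hηs τ hτ) hz2).1
  have hφ1 : φ 1 = 0 := by simp [hφ]
  have hφz : φ ‖z‖ = reflectedRe Q c z - (Q z).re := by
    simp only [hφ]
    rw [← reflectedRe_mul hzn hu1, ← hzu]
  have h1mem : (1 : ℝ) ∈ ball (1 : ℝ) η := mem_ball_self hη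
  refine ⟨fun h => ?_, fun h => ?_⟩
  · have := hmono h1mem hz1 h
    rw [hφ1, hφz] at this
    linarith
  · have := hmono.monotoneOn hz1 h1mem h
    rw [hφ1, hφz] at this
    linarith

lemma ball_zero_eventually {z₀ : ℂ} (hz₀ : ‖z₀‖ = 1) {ρ : ℝ} (hρ : 1 < ρ) :
    ∀ᶠ z in 𝓝 z₀, z ∈ ball (0 : ℂ) ρ :=
  isOpen_ball.mem_nhds (by rwa [mem_ball_zero_iff, hz₀])

/-- A lower bound for the radial derivative of the Poisson extension of the boundary values of
a nonnegative superharmonic function. -/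
lemma IsNonnegSuperharmonicOn.neg_le_re_mul_deriv {w : ℂ → ℝ≥0∞} {R : ℝ}
    (hw : IsNonnegSuperharmonicOn w (ball 0 R)) {ρ : ℝ} (hρ : 1 < ρ) (hρR : ρ < R) {Q : ℂ → ℂ}
    {σ : ℝ} (hσ : 1 < σ) (hQ : DifferentiableOn ℂ Q (ball 0 σ))
    (hbd : ∀ z : ℂ, ‖z‖ = 1 → w z = ENNReal.ofReal (Q z).re)
    (hpos : ∀ z : ℂ, ‖z‖ = 1 → 0 ≤ (Q z).re) {C : ℝ}
    (hC : ∀ z : ℂ, ‖z‖ = ρ⁻¹ → (Q z).re ≤ C) {z₀ : ℂ} (hz₀ : ‖z₀‖ = 1) :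
    -(C / Real.log ρ) / 2 ≤ (z₀ * deriv Q z₀).re := by
  by_contra hcon
  rw [not_le] at hcon
  have hlog : 0 < Real.log ρ := Real.log_pos hρ
  have hσ0 : 0 < σ := by linarith
  have hUh : InnerProductSpace.HarmonicOnNhd (fun z => (Q z).re) (ball 0 σ) := fun z hz =>
    (hQ.analyticAt (isOpen_ball.mem_nhds hz)).harmonicAt_re
  have hUc : ContinuousOn (fun z => (Q z).re) (ball 0 σ) :=
    Complex.continuous_re.comp_continuousOn hQ.continuousOn
  have hσinv : σ⁻¹ < 1 := inv_lt_one_of_one_lt₀ hσ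
  have hVh : ∀ z : ℂ, σ⁻¹ < ‖z‖ →
      InnerProductSpace.HarmonicAt (reflectedRe Q (C / Real.log ρ)) z := fun z hz =>
    harmonicAt_reflectedRe hσ0 hQ _ hz
  have hVc : ∀ z : ℂ, σ⁻¹ < ‖z‖ → ContinuousAt (reflectedRe Q (C / Real.log ρ)) z := fun z hz =>
    (hVh z hz).1.continuousAt
  have hin : ∀ z ∈ closedBall (0 : ℂ) 1, ENNReal.ofReal (Q z).re ≤ w z := by
    refine hw.ofReal_le (isCompact_closedBall 0 1) isOpen_ball ball_subset_closedBall
      (closedBall_subset_ball (by linarith)) (hUc.mono (closedBall_subset_ball hσ))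
      (hUh.mono (ball_subset_ball hσ.le)) fun z hz => ?_
    have h1 : ‖z‖ = 1 := by
      simp only [Set.mem_sdiff, mem_closedBall_zero_iff, mem_ball_zero_iff, not_lt] at hz
      exact le_antisymm hz.1 hz.2
    exact (hbd z h1).ge
  -- On the unit circle the reflected function is `Re Q = w`. On `|z| = ρ` the logarithm subtracts
  -- exactly `C`, which makes it nonpositive by the bound on `|z| = ρ⁻¹`. The minimum principle then
  -- applies in the annulus.
  have hout : ∀ z ∈ closedBall (0 : ℂ) ρ \ ball 0 1,
      ENNReal.ofReal (reflectedRe Q (C / Real.log ρ) z) ≤ w z := by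
    refine hw.ofReal_le ((isCompact_closedBall 0 ρ).diff isOpen_ball)
      (Ω := ball 0 ρ \ closedBall 0 1) (isOpen_ball.sdiff isClosed_closedBall) ?_ ?_ ?_ ?_ ?_
    · exact sdiff_subset_sdiff ball_subset_closedBall ball_subset_closedBall
    · exact sdiff_subset.trans (closedBall_subset_ball hρR)
    · intro z hz
      simp only [Set.mem_sdiff, mem_ball_zero_iff, not_lt] at hz
      exact (hVc z (hσinv.trans_le hz.2)).continuousWithinAt
    · intro z hz
      simp only [Set.mem_sdiff, mem_closedBall_zero_iff, not_le] at hz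
      exact hVh z (hσinv.trans hz.2)
    · intro z hz
      simp only [Set.mem_sdiff, mem_ball_zero_iff, mem_closedBall_zero_iff, not_lt, not_and,
        not_le] at hz
      rcases hz.1.2.eq_or_lt with h1 | h1
      · have h2 := reflectedRe_mul (Q := Q) (c := C / Real.log ρ) (u := z) one_pos h1.symm
        simp only [Complex.ofReal_one, one_mul, div_one, Real.log_one, mul_zero, sub_zero] at h2
        rw [h2, hbd z h1.symm]
      · have h2 : ‖z‖ = ρ := by
          refine le_antisymm hz.1.1 ?_
          by_contra h
          exact absurd (hz.2 (not_le.1 h)) (not_le.2 h1)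
        rw [ENNReal.ofReal_of_nonpos]
        · simp
        · rw [reflectedRe, h2, div_mul_cancel₀ _ hlog.ne']
          have := hC ((starRingEnd ℂ) z)⁻¹ (by rw [norm_inv, Complex.norm_conj, h2])
          linarith
  have hev := (eventually_reflectedRe_sub_sign hσ hQ hz₀ hcon).and
    ((ball_zero_eventually hz₀ hρ).and ((ball_zero_eventually hz₀ hσ).and
      (continuous_norm.continuousAt.eventually (lt_mem_nhds (a := σ⁻¹) (by simpa [hz₀] using hσinv)))))
  obtain ⟨r, hr, hball⟩ := nhds_basis_closedBall.eventually_iff.1 hev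
  -- Near `z₀` the larger of the two functions is always the one known to minorize `w` on that side
  -- of the circle.
  have hle : ∀ z ∈ closedBall z₀ r,
      ENNReal.ofReal (max (Q z).re (reflectedRe Q (C / Real.log ρ) z)) ≤ w z := by
    intro z hz
    obtain ⟨⟨h1, h2⟩, h3, -, -⟩ := hball hz
    rcases le_or_gt ‖z‖ 1 with h | h
    · rw [max_eq_left (h2 h)]
      exact hin z (by rwa [mem_closedBall_zero_iff])
    · rw [max_eq_right (h1 h).le]
      refine hout z ⟨ball_subset_closedBall h3, ?_⟩
      rw [mem_ball_zero_iff, not_lt]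
      exact h.le
  have hc1 : Continuous fun θ => (Q (z₀ + r * expCircle θ)).re :=
    continuous_comp_add_mul_expCircle hr.le (U := fun z => (Q z).re)
      (hUc.mono fun z hz => (hball hz).2.2.1)
  have hc2 : Continuous fun θ => reflectedRe Q (C / Real.log ρ) (z₀ + r * expCircle θ) :=
    continuous_comp_add_mul_expCircle hr.le
      fun z hz => (hVc z (hball hz).2.2.2).continuousWithinAt
  have hmean : ∫ θ, (Q (z₀ + r * expCircle θ)).re = (Q z₀).re :=
    integral_expCircle_of_harmonic (U := fun z => (Q z).re) hr.le
      (hUh.mono fun z hz => (hball hz).2.2.1)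
  obtain ⟨x, rfl⟩ := exists_expCircle_eq hz₀
  -- The maximum strictly exceeds `Re Q` at the outermost point of the small circle, so its mean
  -- strictly exceeds `Re Q(z₀) = w z₀`.
  have hlt : ∫ θ, (Q (expCircle x + r * expCircle θ)).re <
      ∫ θ, max (Q (expCircle x + r * expCircle θ)).re
        (reflectedRe Q (C / Real.log ρ) (expCircle x + r * expCircle θ)) := by
    rw [← sub_pos, ← integral_sub (Continuous.integrable_circle (hc1.max hc2))
      (Continuous.integrable_circle hc1)]
    refine ((hc1.max hc2).sub hc1).integral_pos_of_hasCompactSupport_nonneg_nonzero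
      (HasCompactSupport.of_compactSpace _) (fun θ => sub_nonneg.2 (le_max_left _ _)) (x := x) ?_
    have h1 : expCircle x + r * expCircle x ∈ closedBall (expCircle x) r :=
      add_mul_expCircle_mem_closedBall _ hr.le x
    have h2 : 1 < ‖expCircle x + r * expCircle x‖ := by
      rw [show expCircle x + r * expCircle x = ((1 + r : ℝ) : ℂ) * expCircle x by push_cast; ring,
        norm_mul, norm_expCircle, mul_one, Complex.norm_real, Real.norm_of_nonneg (by linarith)]
      linarith
    have h3 := (hball h1).1.1 h2
    rw [max_eq_right h3.le]
    exact (sub_pos.2 h3).ne'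
  have hfin : ENNReal.ofReal (∫ θ, max (Q (expCircle x + r * expCircle θ)).re
        (reflectedRe Q (C / Real.log ρ) (expCircle x + r * expCircle θ))) ≤
      ENNReal.ofReal (Q (expCircle x)).re := by
    rw [← hbd _ hz₀]
    refine le_trans (ofReal_integral_le_lintegral_ofReal
      (Continuous.integrable_circle (hc1.max hc2))) ?_
    refine le_trans (lintegral_mono fun θ => hle _ (add_mul_expCircle_mem_closedBall _ hr.le θ)) ?_
    refine hw.lintegral_le _ r hr fun z hz => ?_
    exact ball_subset_ball hρR.le (hball hz).2.1
  rw [hmean] at hlt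
  have := (ENNReal.ofReal_le_ofReal_iff (hpos _ hz₀)).1 hfin
  linarith

/-! ### The Poisson kernel and the Herglotz integral. -/

lemma expCircle_sub_ne_zero {ζ : ℂ} (hζ : ‖ζ‖ < 1) (x : UnitAddCircle) : expCircle x - ζ ≠ 0 := by
  intro h
  rw [sub_eq_zero] at h
  rw [← h, norm_expCircle] at hζ
  exact lt_irrefl _ hζ

lemma poissonKernel_expCircle (ζ : ℂ) (x : UnitAddCircle) :
    poissonKernel 0 ζ (expCircle x) = (1 - ‖ζ‖ ^ 2) / ‖expCircle x - ζ‖ ^ 2 := by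
  simp [poissonKernel_def]

lemma poissonKernel_expCircle_nonneg {ζ : ℂ} (hζ : ‖ζ‖ < 1) (x : UnitAddCircle) :
    0 ≤ poissonKernel 0 ζ (expCircle x) := by
  rw [poissonKernel_expCircle]
  have := norm_nonneg ζ
  have : 0 ≤ 1 - ‖ζ‖ ^ 2 := by nlinarith
  positivity

lemma poissonKernel_expCircle_le {ζ : ℂ} (hζ : ‖ζ‖ < 1) (x : UnitAddCircle) :
    poissonKernel 0 ζ (expCircle x) ≤ (1 + ‖ζ‖) / (1 - ‖ζ‖) := by
  have h := re_herglotzRieszKernel_le (c := 0) (R := 1) (z := expCircle x) (w := ζ) (by simp)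
    (by simpa using hζ)
  rw [poissonKernel_eq_re_herglotzRieszKernel]
  simpa [herglotzRieszKernel_def] using h

lemma continuous_poissonKernel_expCircle {ζ : ℂ} (hζ : ‖ζ‖ < 1) :
    Continuous fun x => poissonKernel 0 ζ (expCircle x) := by
  simp only [poissonKernel_expCircle]
  refine Continuous.div (by fun_prop) (by fun_prop) fun x => ?_
  have := norm_pos_iff.2 (expCircle_sub_ne_zero hζ x)
  positivity

/-- Rotation invariance of the kernel turns the Poisson integral on the circle of radius `s` into a
convolution. -/
lemma poissonKernel_mul_expCircle (ζ : ℂ) (x y : UnitAddCircle) :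
    poissonKernel 0 (ζ * expCircle x) (expCircle y) = poissonKernel 0 ζ (expCircle (y - x)) := by
  rw [poissonKernel_expCircle, poissonKernel_expCircle, norm_mul, norm_expCircle, mul_one,
    expCircle_sub]
  congr 2
  rw [show expCircle y / expCircle x - ζ = (expCircle y - ζ * expCircle x) / expCircle x by
    field_simp [expCircle_ne_zero x], norm_div, norm_expCircle, div_one]

/-- The Poisson integral formula on `ℝ/ℤ`. -/
lemma integral_poissonKernel_smul {f : ℂ → ℂ} (hf : DiffContOnCl ℂ f (ball 0 1)) {ζ : ℂ}
    (hζ : ‖ζ‖ < 1) : ∫ x, poissonKernel 0 ζ (expCircle x) • f (expCircle x) = f ζ := by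
  have h := hf.circleAverage_poissonKernel_smul (w := ζ) (by simpa using hζ)
  rwa [← integral_comp_expCircle] at h

lemma integral_poissonKernel {ζ : ℂ} (hζ : ‖ζ‖ < 1) :
    ∫ x, poissonKernel 0 ζ (expCircle x) = 1 := by
  have h := integral_poissonKernel_smul (f := fun _ => 1) diffContOnCl_const hζ
  simp only [Complex.real_smul, mul_one] at h
  rw [integral_complex_ofReal] at h
  exact_mod_cast h

/-- The Herglotz integral of a real function on the unit circle. -/
noncomputable def herglotzIntegral (g : ℂ → ℝ) (ζ : ℂ) : ℂ :=
  Real.circleAverage (fun z => herglotzRieszKernel 0 ζ z • (g z : ℂ)) 0 1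

lemma hasDerivAt_herglotzIntegral {g : ℂ → ℝ} (hg : Integrable fun x => g (expCircle x)) {ζ : ℂ}
    (hζ : ‖ζ‖ < 1) :
    HasDerivAt (herglotzIntegral g)
      (∫ x, (2 * expCircle x / (expCircle x - ζ) ^ 2) * (g (expCircle x) : ℂ)) ζ := by
  have h := hasDerivAt_circleAverage_herglotzRieszKernel_smul (f := fun z => (g z : ℂ))
    (circleIntegrable_of_integrable_comp_expCircle hg.ofReal) (w := ζ) (by simpa using hζ)
  rw [← integral_comp_expCircle] at h
  exact h

lemma re_herglotzIntegral {g : ℂ → ℝ} (hg : Integrable fun x => g (expCircle x)) {ζ : ℂ}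
    (hζ : ‖ζ‖ < 1) :
    (herglotzIntegral g ζ).re = ∫ x, poissonKernel 0 ζ (expCircle x) * g (expCircle x) := by
  rw [herglotzIntegral, re_circleAverage_herglotzRieszKernel_smul
    (circleIntegrable_of_integrable_comp_expCircle hg) (by simpa using hζ),
    ← integral_comp_expCircle, poissonKernel_eq_re_herglotzRieszKernel]
  rfl

/-- The kernel has mean `1`: it is `2 z / (z - ζ) - 1`, and Cauchy's formula gives mean `1` for `z /
(z - ζ)`. -/
lemma herglotzIntegral_const_sub {g : ℂ → ℝ} (hg : Integrable fun x => g (expCircle x)) (b : ℝ)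
    {ζ : ℂ} (hζ : ‖ζ‖ < 1) :
    herglotzIntegral (fun z => b - g z) ζ = b - herglotzIntegral g ζ := by
  have hK : Continuous fun x => herglotzRieszKernel 0 ζ (expCircle x) := by
    simp only [herglotzRieszKernel_def, sub_zero]
    exact Continuous.div (by fun_prop) (by fun_prop) (expCircle_sub_ne_zero hζ)
  have hKi : Integrable fun x => herglotzRieszKernel 0 ζ (expCircle x) :=
    hK.integrable_of_hasCompactSupport (HasCompactSupport.of_compactSpace _)
  have hgi : Integrable fun x => herglotzRieszKernel 0 ζ (expCircle x) * (g (expCircle x) : ℂ) := by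
    obtain ⟨C, hC⟩ := (isCompact_range hK).isBounded.exists_norm_le
    exact hg.ofReal.bdd_mul hK.aestronglyMeasurable
      (Eventually.of_forall fun x => hC _ (mem_range_self x))
  have hK1 : ∫ x, herglotzRieszKernel 0 ζ (expCircle x) = 1 := by
    have h := (diffContOnCl_const (𝕜 := ℂ) (s := ball (0 : ℂ) |1|) (c := (1 : ℂ))).circleAverage_smul_div
      (R := 1) (w := ζ) (by simpa using hζ)
    rw [← integral_comp_expCircle] at h
    have hc : Continuous fun x => (expCircle x - 0) / (expCircle x - ζ) :=
      Continuous.div (by fun_prop) (by fun_prop) (expCircle_sub_ne_zero hζ)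
    have h2 : ∀ x, herglotzRieszKernel 0 ζ (expCircle x) =
        2 * ((expCircle x - 0) / (expCircle x - ζ)) - 1 := fun x => by
      rw [herglotzRieszKernel_def]
      field_simp [expCircle_sub_ne_zero hζ x]
      ring
    simp only [smul_eq_mul, mul_one] at h
    simp_rw [h2]
    rw [integral_sub ((hc.integrable_of_hasCompactSupport
      (HasCompactSupport.of_compactSpace _)).const_mul 2) (integrable_const _),
      integral_const_mul, h]
    simp [measureReal_def]
    norm_num
  simp only [herglotzIntegral]
  rw [← integral_comp_expCircle, ← integral_comp_expCircle]
  simp only [smul_eq_mul, Complex.ofReal_sub, mul_sub]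
  rw [integral_sub (hKi.mul_const _) hgi, integral_mul_const, hK1, one_mul]

/-! ### Poisson averages: basic bounds. -/

/-- Convolution with the Poisson kernel of radius `s`. -/
noncomputable def poissonAverage {E : Type*} [NormedAddCommGroup E] [NormedSpace ℝ E] (s : ℝ)
    (h : UnitAddCircle → E) (x : UnitAddCircle) : E :=
  ∫ y, poissonKernel 0 s (expCircle (y - x)) • h y

section PoissonAverage

variable {E : Type*} [NormedAddCommGroup E] [NormedSpace ℝ E] {s : ℝ}

lemma norm_ofReal_lt_one (hs : 0 ≤ s) (hs1 : s < 1) : ‖(s : ℂ)‖ < 1 := by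
  rwa [Complex.norm_real, Real.norm_of_nonneg hs]

lemma integrable_poissonKernel_smul (hs : 0 ≤ s) (hs1 : s < 1) {h : UnitAddCircle → E}
    (hh : Integrable h) (x : UnitAddCircle) :
    Integrable fun y => poissonKernel 0 s (expCircle (y - x)) • h y := by
  have hc := continuous_poissonKernel_expCircle (norm_ofReal_lt_one hs hs1)
  refine hh.bdd_smul ((1 + ‖(s : ℂ)‖) / (1 - ‖(s : ℂ)‖))
    (hc.comp (continuous_sub_right x)).aestronglyMeasurable (Eventually.of_forall fun y => ?_)
  rw [Real.norm_of_nonneg (poissonKernel_expCircle_nonneg (norm_ofReal_lt_one hs hs1) _)]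
  exact poissonKernel_expCircle_le (norm_ofReal_lt_one hs hs1) _

lemma continuous_poissonAverage (hs : 0 ≤ s) (hs1 : s < 1) {h : UnitAddCircle → E}
    (hh : Integrable h) : Continuous (poissonAverage s h) := by
  have hc := continuous_poissonKernel_expCircle (norm_ofReal_lt_one hs hs1)
  refine continuous_of_dominated
    (bound := fun y => (1 + ‖(s : ℂ)‖) / (1 - ‖(s : ℂ)‖) * ‖h y‖) (fun x => ?_) (fun x => ?_)
    (hh.norm.const_mul _) (Eventually.of_forall fun y => ?_)
  · exact (integrable_poissonKernel_smul hs hs1 hh x).aestronglyMeasurable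
  · refine Eventually.of_forall fun y => ?_
    rw [norm_smul,
      Real.norm_of_nonneg (poissonKernel_expCircle_nonneg (norm_ofReal_lt_one hs hs1) _)]
    gcongr
    exact poissonKernel_expCircle_le (norm_ofReal_lt_one hs hs1) _
  · exact (hc.comp (continuous_sub_left y)).smul continuous_const

lemma norm_poissonAverage_le (hs : 0 ≤ s) (hs1 : s < 1) (h : UnitAddCircle → E)
    (x : UnitAddCircle) : ‖poissonAverage s h x‖ ≤ poissonAverage s (fun y => ‖h y‖) x := by
  refine (norm_integral_le_integral_norm _).trans (le_of_eq ?_)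
  refine integral_congr_ae (Eventually.of_forall fun y => ?_)
  simp only
  rw [norm_smul, Real.norm_of_nonneg
    (poissonKernel_expCircle_nonneg (norm_ofReal_lt_one hs hs1) _), smul_eq_mul]

lemma integral_poissonKernel_sub (hs : 0 ≤ s) (hs1 : s < 1) (x : UnitAddCircle) :
    ∫ y, poissonKernel 0 s (expCircle (y - x)) = 1 := by
  rw [integral_sub_right_eq_self (fun y => poissonKernel 0 s (expCircle y)) x]
  exact integral_poissonKernel (norm_ofReal_lt_one hs hs1)

lemma integral_poissonKernel_sub_left (hs : 0 ≤ s) (hs1 : s < 1) (y : UnitAddCircle) :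
    ∫ x, poissonKernel 0 s (expCircle (y - x)) = 1 := by
  rw [integral_sub_left_eq_self (fun y => poissonKernel 0 s (expCircle y)) volume y]
  exact integral_poissonKernel (norm_ofReal_lt_one hs hs1)

lemma integral_poissonAverage (hs : 0 ≤ s) (hs1 : s < 1) {h : UnitAddCircle → ℝ}
    (hh : Integrable h) : ∫ x, poissonAverage s h x = ∫ y, h y := by
  have hc := continuous_poissonKernel_expCircle (norm_ofReal_lt_one hs hs1)
  simp only [poissonAverage]
  rw [integral_integral_swap]
  · refine integral_congr_ae (Eventually.of_forall fun y => ?_)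
    simp only
    rw [integral_smul_const, integral_poissonKernel_sub_left hs hs1, one_smul]
  · have h1 : Integrable (fun p : UnitAddCircle × UnitAddCircle => h p.2) (volume.prod volume) :=
      hh.comp_snd volume
    refine h1.bdd_smul ((1 + ‖(s : ℂ)‖) / (1 - ‖(s : ℂ)‖))
      (hc.comp (continuous_snd.sub continuous_fst)).aestronglyMeasurable
      (Eventually.of_forall fun y => ?_)
    simp only [Function.comp_apply]
    rw [Real.norm_of_nonneg (poissonKernel_expCircle_nonneg (norm_ofReal_lt_one hs hs1) _)]
    exact poissonKernel_expCircle_le (norm_ofReal_lt_one hs hs1) _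

end PoissonAverage

section

variable {E : Type*} [NormedAddCommGroup E] [NormedSpace ℝ E] {s : ℝ}

lemma poissonAverage_add (hs : 0 ≤ s) (hs1 : s < 1) {g h : UnitAddCircle → E} (hg : Integrable g)
    (hh : Integrable h) (x : UnitAddCircle) :
    poissonAverage s (fun y => g y + h y) x = poissonAverage s g x + poissonAverage s h x := by
  simp only [poissonAverage, smul_add]
  exact integral_add (integrable_poissonKernel_smul hs hs1 hg x)
    (integrable_poissonKernel_smul hs hs1 hh x)

lemma poissonAverage_sub (hs : 0 ≤ s) (hs1 : s < 1) {g h : UnitAddCircle → E} (hg : Integrable g)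
    (hh : Integrable h) (x : UnitAddCircle) :
    poissonAverage s (fun y => g y - h y) x = poissonAverage s g x - poissonAverage s h x := by
  simp only [poissonAverage, smul_sub]
  exact integral_sub (integrable_poissonKernel_smul hs hs1 hg x)
    (integrable_poissonKernel_smul hs hs1 hh x)

lemma poissonAverage_const_mul (c : ℂ) (g : UnitAddCircle → ℂ) (x : UnitAddCircle) :
    poissonAverage s (fun y => c * g y) x = c * poissonAverage s g x := by
  simp only [poissonAverage]
  rw [← integral_const_mul]
  congr 1
  ext y
  simp only [Complex.real_smul]
  ring

lemma poissonAverage_le_of_le (hs : 0 ≤ s) (hs1 : s < 1) {h : UnitAddCircle → ℝ}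
    (hh : Integrable h) {C : ℝ} (hC : ∀ᵐ y, h y ≤ C) (x : UnitAddCircle) :
    poissonAverage s h x ≤ C := by
  have h1 : Integrable fun y => poissonKernel 0 s (expCircle (y - x)) • C :=
    integrable_poissonKernel_smul hs hs1 (integrable_const C) x
  calc poissonAverage s h x ≤ ∫ y, poissonKernel 0 s (expCircle (y - x)) • C := by
        refine integral_mono_ae (integrable_poissonKernel_smul hs hs1 hh x) h1 ?_
        filter_upwards [hC] with y hy
        exact mul_le_mul_of_nonneg_left hy
          (poissonKernel_expCircle_nonneg (norm_ofReal_lt_one hs hs1) _)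
    _ = C := by
        rw [integral_smul_const, integral_poissonKernel_sub hs hs1, one_smul]

end

/-! ### Poisson averages: convergence as the radius tends to one. -/

lemma integrable_continuousMap {E : Type*} [NormedAddCommGroup E] (g : C(UnitAddCircle, E)) :
    Integrable g :=
  g.continuous.integrable_of_hasCompactSupport (HasCompactSupport.of_compactSpace _)

lemma poissonAverage_pow {s : ℝ} (hs : 0 ≤ s) (hs1 : s < 1) (n : ℕ) (x : UnitAddCircle) :
    poissonAverage s (fun y => expCircle y ^ n) x = (s * expCircle x) ^ n := by
  have h := integral_poissonKernel_smul (f := fun z => z ^ n) (ζ := s * expCircle x)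
    (Differentiable.diffContOnCl (by fun_prop))
    (by rw [norm_mul, norm_expCircle, mul_one]; exact norm_ofReal_lt_one hs hs1)
  simp only [poissonKernel_mul_expCircle] at h
  exact h

/-- For `n ≥ 0` this is the Poisson formula for `z ^ n`; negative frequencies follow by conjugation,
since the kernel is real. -/
lemma poissonAverage_fourier {s : ℝ} (hs : 0 ≤ s) (hs1 : s < 1) (n : ℤ) (x : UnitAddCircle) :
    poissonAverage s (fun y => fourier n y) x = (s : ℂ) ^ n.natAbs * fourier n x := by
  obtain ⟨k, rfl | rfl⟩ := n.eq_nat_or_neg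
  · have h1 : ∀ y : UnitAddCircle, fourier (k : ℤ) y = expCircle y ^ k := fun y => by
      rw [fourier_apply, expCircle, AddCircle.toCircle_zsmul]
      simp
    simp only [h1]
    rw [poissonAverage_pow hs hs1, mul_pow]
    simp
  · have h1 : ∀ y : UnitAddCircle, fourier (-(k : ℤ)) y = (starRingEnd ℂ) (expCircle y ^ k) :=
      fun y => by
        rw [fourier_neg, fourier_apply, expCircle, AddCircle.toCircle_zsmul]
        simp
    simp only [h1]
    have h2 := congrArg (starRingEnd ℂ) (poissonAverage_pow hs hs1 k x)
    rw [poissonAverage, ← integral_conj] at h2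
    simp only [Complex.real_smul, map_mul, Complex.conj_ofReal] at h2
    simp only [poissonAverage, Complex.real_smul]
    rw [h2, ← Complex.conj_ofReal, ← map_pow]
    simp [mul_pow]

/-- Poisson averages of a continuous function converge uniformly. -/
lemma eventually_norm_poissonAverage_sub_le (g : C(UnitAddCircle, ℂ)) {ε : ℝ} (hε : 0 < ε) :
    ∀ᶠ s in 𝓝[<] (1 : ℝ), ∀ x, ‖poissonAverage s g x - g x‖ ≤ ε := by
  have hs01 : ∀ᶠ s in 𝓝[<] (1 : ℝ), s ∈ Ioo (0 : ℝ) 1 := Ioo_mem_nhdsLT one_pos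
  -- The claim is explicit for characters and passes to their span, then to its uniform closure
  -- because Poisson averaging contracts the sup norm.
  have hspan : ∀ f ∈ Submodule.span ℂ (range (fourier (T := 1))), ∀ ε : ℝ, 0 < ε →
      ∀ᶠ s in 𝓝[<] (1 : ℝ), ∀ x, ‖poissonAverage s f x - f x‖ ≤ ε := by
    intro f hf
    induction hf using Submodule.span_induction with
    | mem f hf =>
      obtain ⟨n, rfl⟩ := hf
      intro ε hε
      have h1 : Tendsto (fun s : ℝ => ‖(s : ℂ) ^ n.natAbs - 1‖) (𝓝[<] 1) (𝓝 0) := by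
        have : Continuous fun s : ℝ => ‖(s : ℂ) ^ n.natAbs - 1‖ := by fun_prop
        have h := this.tendsto 1
        simp only [Complex.ofReal_one, one_pow, sub_self, norm_zero] at h
        exact h.mono_left nhdsWithin_le_nhds
      filter_upwards [hs01, h1.eventually (gt_mem_nhds hε)] with s hs h2 x
      rw [poissonAverage_fourier hs.1.le hs.2]
      calc ‖(s : ℂ) ^ n.natAbs * fourier n x - fourier n x‖
          = ‖(s : ℂ) ^ n.natAbs - 1‖ * ‖fourier n x‖ := by rw [← norm_mul]; congr 1; ring
        _ = ‖(s : ℂ) ^ n.natAbs - 1‖ := by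
            rw [show ‖fourier n x‖ = 1 from Circle.norm_coe _, mul_one]
        _ ≤ ε := h2.le
    | zero =>
      intro ε hε
      filter_upwards with s x
      simp [poissonAverage, hε.le]
    | add f g _ _ hf hg =>
      intro ε hε
      filter_upwards [hs01, hf (ε / 2) (by positivity), hg (ε / 2) (by positivity)] with s hs h1 h2 x
      have h3 := poissonAverage_add hs.1.le hs.2 (integrable_continuousMap f)
        (integrable_continuousMap g) x
      have h4 : ⇑(f + g) = fun y => f y + g y := rfl
      rw [h4, h3]
      calc _ = ‖(poissonAverage s f x - f x) + (poissonAverage s g x - g x)‖ := by congr 1; ring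
        _ ≤ ε / 2 + ε / 2 := (norm_add_le _ _).trans (add_le_add (h1 x) (h2 x))
        _ = ε := by ring
    | smul c f _ hf =>
      intro ε hε
      filter_upwards [hf (ε / (‖c‖ + 1)) (by positivity)] with s h1 x
      have h4 : ⇑(c • f) = fun y => c * f y := rfl
      rw [h4, poissonAverage_const_mul, ← mul_sub, norm_mul]
      calc ‖c‖ * ‖poissonAverage s f x - f x‖ ≤ (‖c‖ + 1) * (ε / (‖c‖ + 1)) := by
            gcongr
            · linarith
            · exact h1 x
        _ = ε := by field_simp
  have hg : g ∈ (Submodule.span ℂ (range (fourier (T := 1)))).topologicalClosure := by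
    rw [span_fourier_closure_eq_top]; trivial
  obtain ⟨f, hf, hgf⟩ := Metric.mem_closure_iff.1 hg (ε / 3) (by positivity)
  filter_upwards [hs01, hspan f hf (ε / 3) (by positivity)] with s hs h1 x
  have hd : ∀ y, ‖g y - f y‖ ≤ ε / 3 := fun y => by
    rw [← dist_eq_norm]
    exact (ContinuousMap.dist_apply_le_dist y).trans hgf.le
  have h2 : ‖poissonAverage s g x - poissonAverage s f x‖ ≤ ε / 3 := by
    rw [← poissonAverage_sub hs.1.le hs.2 (integrable_continuousMap g) (integrable_continuousMap f)]
    refine (norm_poissonAverage_le hs.1.le hs.2 _ x).trans ?_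
    exact poissonAverage_le_of_le hs.1.le hs.2
      ((integrable_continuousMap g).sub (integrable_continuousMap f)).norm
      (Eventually.of_forall hd) x
  calc ‖poissonAverage s g x - g x‖
      = ‖(poissonAverage s g x - poissonAverage s f x) + (poissonAverage s f x - f x)
        - (g x - f x)‖ := by congr 1; ring
    _ ≤ ε / 3 + ε / 3 + ε / 3 :=
        (norm_sub_le _ _).trans (add_le_add ((norm_add_le _ _).trans (add_le_add h2 (h1 x))) (hd x))
    _ = ε := by ring

lemma integral_norm_poissonAverage_le {s : ℝ} (hs : 0 ≤ s) (hs1 : s < 1) {h : UnitAddCircle → ℂ}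
    (hh : Integrable h) : ∫ x, ‖poissonAverage s h x‖ ≤ ∫ x, ‖h x‖ := by
  rw [← integral_poissonAverage hs hs1 hh.norm]
  exact integral_mono
    ((continuous_poissonAverage hs hs1 hh).norm.integrable_of_hasCompactSupport
      (HasCompactSupport.of_compactSpace _))
    ((continuous_poissonAverage hs hs1 hh.norm).integrable_of_hasCompactSupport
      (HasCompactSupport.of_compactSpace _)) fun x => norm_poissonAverage_le hs hs1 h x

/-- Poisson averages converge in `L¹`. -/
lemma tendsto_integral_norm_poissonAverage_sub {h : UnitAddCircle → ℂ} (hh : Integrable h) :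
    Tendsto (fun s => ∫ x, ‖poissonAverage s h x - h x‖) (𝓝[<] (1 : ℝ)) (𝓝 0) := by
  have hs01 : ∀ᶠ s in 𝓝[<] (1 : ℝ), s ∈ Ioo (0 : ℝ) 1 := Ioo_mem_nhdsLT one_pos
  rw [Metric.tendsto_nhds]
  intro ε hε
  obtain ⟨g, hg, -⟩ := hh.exists_boundedContinuous_integral_sub_le (ε := ε / 4) (by positivity)
  have hgi := integrable_continuousMap g.toContinuousMap
  filter_upwards [hs01, eventually_norm_poissonAverage_sub_le g.toContinuousMap
    (ε := ε / 4) (by positivity)] with s hs h1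
  have hTi : ∀ {f : UnitAddCircle → ℂ}, Integrable f → Integrable (poissonAverage s f) :=
    fun hf => (continuous_poissonAverage hs.1.le hs.2 hf).integrable_of_hasCompactSupport
      (HasCompactSupport.of_compactSpace _)
  rw [Real.dist_eq, sub_zero, abs_of_nonneg (integral_nonneg fun x => norm_nonneg _)]
  have h2 : ∀ x, ‖poissonAverage s h x - h x‖ ≤
      ‖poissonAverage s (fun y => h y - g y) x‖ + (ε / 4 + ‖h x - g x‖) := fun x => by
    have h3 := poissonAverage_sub hs.1.le hs.2 hh hgi x
    calc ‖poissonAverage s h x - h x‖ = ‖poissonAverage s (fun y => h y - g y) x +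
        ((poissonAverage s g x - g x) - (h x - g x))‖ := by
          congr 1
          have : poissonAverage s (fun y => h y - g y) x =
            poissonAverage s h x - poissonAverage s g x := h3
          rw [this]; ring
      _ ≤ _ := (norm_add_le _ _).trans (add_le_add le_rfl ((norm_sub_le _ _).trans
          (add_le_add (h1 x) le_rfl)))
  have hi1 : Integrable fun x => ‖poissonAverage s (fun y => h y - g y) x‖ :=
    (hTi (hh.sub hgi)).norm
  have hi3 : Integrable fun x => ‖h x - g x‖ := (hh.sub hgi).norm
  have hi2 : Integrable fun x => ε / 4 + ‖h x - g x‖ :=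
    (integrable_const _).add (hh.sub hgi).norm
  calc ∫ x, ‖poissonAverage s h x - h x‖
      ≤ ∫ x, (‖poissonAverage s (fun y => h y - g y) x‖ + (ε / 4 + ‖h x - g x‖)) :=
        integral_mono ((hTi hh).sub hh).norm (hi1.add hi2) h2
    _ = (∫ x, ‖poissonAverage s (fun y => h y - g y) x‖) + (ε / 4 + ∫ x, ‖h x - g x‖) := by
        rw [integral_add hi1 hi2, integral_add (integrable_const _) hi3]
        simp [measureReal_def]
    _ ≤ ε / 4 + (ε / 4 + ε / 4) := by
        gcongr
        exact (integral_norm_poissonAverage_le hs.1.le hs.2 (hh.sub hgi)).trans hg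
    _ < ε := by linarith

/-! ### Increments of the conjugate function along arcs. -/

lemma hasDerivAt_expCircle_coe (t : ℝ) :
    HasDerivAt (fun t : ℝ => expCircle (t : UnitAddCircle))
      (2 * π * Complex.I * expCircle (t : UnitAddCircle)) t := by
  have h1 : HasDerivAt (fun z : ℂ => Complex.exp (2 * π * z * Complex.I))
      (Complex.exp (2 * π * t * Complex.I) * (2 * π * Complex.I)) (t : ℂ) := by
    refine HasDerivAt.cexp ?_
    simpa using ((hasDerivAt_id (t : ℂ)).const_mul (2 * π : ℂ)).mul_const Complex.I
  have h2 := h1.comp_ofReal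
  simp only [expCircle_coe]
  exact h2.congr_deriv (mul_comm _ _)

@[fun_prop] lemma continuous_expCircle_coe :
    Continuous fun t : ℝ => expCircle (t : UnitAddCircle) :=
  continuous_expCircle.comp (AddCircle.continuous_mk' 1)

lemma norm_expCircle_coe_sub_one_le (t : ℝ) : ‖expCircle (t : UnitAddCircle) - 1‖ ≤ 2 * π * |t| := by
  have h := Real.norm_exp_I_mul_ofReal_sub_one_le (x := 2 * π * t)
  rw [Real.norm_eq_abs, abs_mul, abs_of_pos (by positivity : (0 : ℝ) < 2 * π)] at h
  rw [expCircle_coe]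
  convert h using 4
  push_cast
  ring

lemma norm_expCircle_sub_ofReal_sq (x : UnitAddCircle) (r : ℝ) :
    ‖expCircle x - r‖ ^ 2 = (1 - r) ^ 2 + r * ‖expCircle x - 1‖ ^ 2 := by
  have h := norm_expCircle x
  rw [← sq_eq_sq₀ (norm_nonneg _) zero_le_one, ← Complex.normSq_eq_norm_sq, Complex.normSq_apply] at h
  rw [← Complex.normSq_eq_norm_sq, ← Complex.normSq_eq_norm_sq, Complex.normSq_apply,
    Complex.normSq_apply]
  simp
  linear_combination (1 - r) * h

section Analytic

variable {Q : ℂ → ℂ} {σ : ℝ}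

lemma expCircle_mem_ball (hσ : 1 < σ) (x : UnitAddCircle) : expCircle x ∈ ball (0 : ℂ) σ := by
  rwa [mem_ball_zero_iff, norm_expCircle]

/-- Cauchy-Riemann on the circle: the tangential derivative of `Im Q` is the radial derivative of
`Re Q`; the factor `2π` comes from the parametrization. -/
lemma hasDerivAt_im_comp_expCircle (hσ : 1 < σ) (hQ : DifferentiableOn ℂ Q (ball 0 σ)) (t : ℝ) :
    HasDerivAt (fun t : ℝ => (Q (expCircle (t : UnitAddCircle))).im)
      (2 * π * (expCircle (t : UnitAddCircle) * deriv Q (expCircle (t : UnitAddCircle))).re) t := by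
  have h1 : HasDerivAt Q (deriv Q (expCircle (t : UnitAddCircle))) (expCircle (t : UnitAddCircle)) :=
    (hQ.differentiableAt (isOpen_ball.mem_nhds (expCircle_mem_ball hσ _))).hasDerivAt
  have h2 := h1.scomp t (hasDerivAt_expCircle_coe t)
  have h3 := (Complex.imCLM.hasFDerivAt).comp_hasDerivAt t h2
  refine h3.congr_deriv ?_
  simp [Complex.mul_im, Complex.mul_re]
  ring

lemma continuousOn_mul_deriv (hQ : DifferentiableOn ℂ Q (ball 0 σ)) :
    DifferentiableOn ℂ (fun z => z * deriv Q z) (ball 0 σ) :=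
  differentiableOn_id.mul (hQ.deriv isOpen_ball)

lemma continuous_re_mul_deriv (hσ : 1 < σ) (hQ : DifferentiableOn ℂ Q (ball 0 σ)) :
    Continuous fun x => (expCircle x * deriv Q (expCircle x)).re :=
  Complex.continuous_re.comp
    ((continuousOn_mul_deriv hQ).continuousOn.comp_continuous continuous_expCircle
      (expCircle_mem_ball hσ))

/-- If the radial derivative of `Re Q` is bounded above on the unit circle, the increments of
`-Im Q` over short arcs are controlled by the radial derivative at one interior point. -/
lemma increment_le (hσ : 1 < σ) (hQ : DifferentiableOn ℂ Q (ball 0 σ)) {κ δ r D : ℝ} (hδ : 0 < δ)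
    (hr : 1 - r = π * δ) (hr0 : 0 < r)
    (hκ : ∀ z : ℂ, ‖z‖ = 1 → 2 * π * (z * deriv Q z).re ≤ κ)
    (hD : ∀ z : ℂ, ‖z‖ = r → -(2 * π * (z * deriv Q z).re) ≤ D) (x : ℝ) :
    (-(Q (expCircle ((x + δ : ℝ) : UnitAddCircle))).im + κ * (x + δ)) -
      (-(Q (expCircle (x : UnitAddCircle))).im + κ * x) ≤ 2 * ((1 - r) / (1 + r) * (κ + D)) := by
  set m : UnitAddCircle → ℝ := fun y => κ - 2 * π * (expCircle y * deriv Q (expCircle y)).re with hm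
  have hmc : Continuous m :=
    continuous_const.sub (continuous_const.mul (continuous_re_mul_deriv hσ hQ))
  have hm0 : ∀ y, 0 ≤ m y := fun y => sub_nonneg.2 (hκ _ (norm_expCircle y))
  have hr1 : r < 1 := by nlinarith [mul_pos Real.pi_pos hδ]
  have hδ1 : δ ≤ 1 := by nlinarith [Real.pi_gt_three]
  have hder : ∀ t : ℝ, HasDerivAt (fun t : ℝ => -(Q (expCircle (t : UnitAddCircle))).im + κ * t)
      (m t) t := fun t => by
    have h := (hasDerivAt_im_comp_expCircle hσ hQ t).neg.add ((hasDerivAt_id t).const_mul κ)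
    refine h.congr_deriv ?_
    simp only [hm]; ring
  have hmcR : Continuous fun t : ℝ => m t := hmc.comp (AddCircle.continuous_mk' 1)
  have hFTC : ∫ t in x..x + δ, m t = (-(Q (expCircle ((x + δ : ℝ) : UnitAddCircle))).im + κ * (x + δ)) -
      (-(Q (expCircle (x : UnitAddCircle))).im + κ * x) :=
    intervalIntegral.integral_eq_sub_of_hasDerivAt (fun t _ => hder t)
      (hmcR.intervalIntegrable _ _)
  rw [← hFTC]
  -- The interior point sits behind the midpoint of the arc. With `1 - r = πδ`, every point of the
  -- arc is within chord distance `1 - r` of that midpoint, so the Poisson kernel at `ζ` is at least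
  -- `(1 + r) / (2 (1 - r))` there; `c` is the reciprocal of this bound.
  set ζ : ℂ := r * expCircle ((x + δ / 2 : ℝ) : UnitAddCircle) with hζ
  have hζn : ‖ζ‖ = r := by
    rw [hζ, norm_mul, norm_expCircle, mul_one, Complex.norm_real, Real.norm_of_nonneg hr0.le]
  have hζ1 : ‖ζ‖ < 1 := by rwa [hζn]
  have hPc := continuous_poissonKernel_expCircle hζ1
  set c : ℝ := 2 * ((1 - r) / (1 + r)) with hc
  have hc0 : 0 ≤ c := by
    have : 0 ≤ 1 - r := by linarith
    positivity
  have hP1 : ∀ t ∈ Icc x (x + δ), 1 ≤ c * poissonKernel 0 ζ (expCircle (t : UnitAddCircle)) := by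
    intro t ht
    rw [hζ, poissonKernel_mul_expCircle, poissonKernel_expCircle, Complex.norm_real,
      Real.norm_of_nonneg hr0.le, norm_expCircle_sub_ofReal_sq]
    have h1 : ‖expCircle ((t : UnitAddCircle) - ((x + δ / 2 : ℝ) : UnitAddCircle)) - 1‖ ≤ 1 - r := by
      rw [← AddCircle.coe_sub]
      refine (norm_expCircle_coe_sub_one_le _).trans ?_
      have : |t - (x + δ / 2)| ≤ δ / 2 := by
        rw [abs_le]; constructor <;> linarith [ht.1, ht.2]
      calc 2 * π * |t - (x + δ / 2)| ≤ 2 * π * (δ / 2) := by gcongr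
        _ = 1 - r := by rw [hr]; ring
    set a := ‖expCircle ((t : UnitAddCircle) - ((x + δ / 2 : ℝ) : UnitAddCircle)) - 1‖ with ha
    have ha0 : 0 ≤ a := norm_nonneg _
    have h1r : 0 < 1 - r := by linarith
    have h2 : a ^ 2 ≤ (1 - r) ^ 2 := by gcongr
    have h3 : (1 - r) ^ 2 + r * a ^ 2 ≤ 2 * (1 - r) ^ 2 := by nlinarith
    have h4 : 0 < (1 - r) ^ 2 + r * a ^ 2 := by positivity
    rw [hc, mul_div_assoc', one_le_div h4]
    refine h3.trans (le_of_eq ?_)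
    field_simp
    ring
  have hcP : Continuous fun t : ℝ => c * poissonKernel 0 ζ (expCircle (t : UnitAddCircle)) * m t :=
    (continuous_const.mul (hPc.comp (AddCircle.continuous_mk' 1))).mul hmcR
  have hcP0 : ∀ t : ℝ, 0 ≤ c * poissonKernel 0 ζ (expCircle (t : UnitAddCircle)) * m t := fun t =>
    mul_nonneg (mul_nonneg hc0 (poissonKernel_expCircle_nonneg hζ1 _)) (hm0 _)
  calc ∫ t in x..x + δ, m t
      ≤ ∫ t in x..x + δ, c * poissonKernel 0 ζ (expCircle (t : UnitAddCircle)) * m t := by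
        refine intervalIntegral.integral_mono_on (by linarith) (hmcR.intervalIntegrable _ _)
          (hcP.intervalIntegrable _ _) fun t ht => ?_
        exact le_mul_of_one_le_left (hm0 _) (hP1 t ht)
    -- The integrand is nonnegative, so the arc may be enlarged to a full period, which gives the
    -- Poisson integral of the harmonic function `κ - 2π Re (z Q'(z))`.
    _ ≤ ∫ t in x..x + 1, c * poissonKernel 0 ζ (expCircle (t : UnitAddCircle)) * m t :=
        intervalIntegral.integral_mono_interval le_rfl (by linarith) (by linarith)
          (Eventually.of_forall hcP0) (hcP.intervalIntegrable _ _)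
    _ = ∫ y, c * poissonKernel 0 ζ (expCircle y) * m y :=
        UnitAddCircle.intervalIntegral_preimage x
          (fun y => c * poissonKernel 0 ζ (expCircle y) * m y)
    _ = c * (κ - 2 * π * (ζ * deriv Q ζ).re) := by
        have hdiff : DiffContOnCl ℂ (fun z => z * deriv Q z) (ball 0 1) := by
          refine DifferentiableOn.diffContOnCl ((continuousOn_mul_deriv hQ).mono ?_)
          exact closure_ball_subset_closedBall.trans (closedBall_subset_ball hσ)
        have h1 := congrArg Complex.re (integral_poissonKernel_smul hdiff hζ1)
        have h1c : Continuous fun x => expCircle x * deriv Q (expCircle x) :=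
          (continuousOn_mul_deriv hQ).continuousOn.comp_continuous continuous_expCircle
            (expCircle_mem_ball hσ)
        have h2 : Integrable fun x => poissonKernel 0 ζ (expCircle x) •
            (expCircle x * deriv Q (expCircle x)) :=
          (hPc.smul h1c).integrable_of_hasCompactSupport (HasCompactSupport.of_compactSpace _)
        have h3 : ∫ x, poissonKernel 0 ζ (expCircle x) *
            (expCircle x * deriv Q (expCircle x)).re = (ζ * deriv Q ζ).re := by
          rw [← h1]
          have := Complex.reCLM.integral_comp_comm h2
          simp only [Complex.reCLM_apply] at this
          rw [← this]
          refine integral_congr_ae (Eventually.of_forall fun x => ?_)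
          simp only [Complex.real_smul, Complex.re_ofReal_mul]
        have h4 : ∀ y, c * poissonKernel 0 ζ (expCircle y) * m y =
            c * (κ * poissonKernel 0 ζ (expCircle y) - 2 * π * (poissonKernel 0 ζ (expCircle y) *
            (expCircle y * deriv Q (expCircle y)).re)) := fun y => by simp only [hm]; ring
        simp_rw [h4]
        rw [integral_const_mul, integral_sub, integral_const_mul, integral_const_mul,
          integral_poissonKernel hζ1, h3, mul_one]
        · exact Continuous.integrable_circle (continuous_const.mul hPc)
        · exact Continuous.integrable_circle
            (continuous_const.mul (hPc.mul (continuous_re_mul_deriv hσ hQ)))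
    _ ≤ c * (κ + D) := by
        refine mul_le_mul_of_nonneg_left ?_ hc0
        have := hD ζ hζn
        linarith
    _ = 2 * ((1 - r) / (1 + r) * (κ + D)) := by rw [hc]; ring

end Analytic

/-! ### Removal of arc averages and exponential integrability. -/

/-- `Q` minus its average over arcs of half-width `δ`. -/
noncomputable def arcDefect (Q : ℂ → ℂ) (δ : ℝ) (z : ℂ) : ℂ :=
  Q z - (((2 * δ)⁻¹ : ℝ) : ℂ) * ∫ t in -δ..δ, Q (z * expCircle (t : UnitAddCircle))

section

variable {Q : ℂ → ℂ} {σ δ : ℝ}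

lemma mul_expCircle_mem_ball {z : ℂ} {τ : ℝ} (hz : z ∈ ball (0 : ℂ) τ) (x : UnitAddCircle) :
    z * expCircle x ∈ ball (0 : ℂ) τ := by
  rw [mem_ball_zero_iff] at hz ⊢
  rwa [norm_mul, norm_expCircle, mul_one]

lemma differentiableOn_arcDefect (hQ : DifferentiableOn ℂ Q (ball 0 σ)) :
    DifferentiableOn ℂ (arcDefect Q δ) (ball 0 σ) := by
  refine hQ.sub (DifferentiableOn.const_mul (fun z hz => ?_) _)
  refine DifferentiableAt.differentiableWithinAt ?_
  obtain ⟨τ, hzτ, hτσ⟩ := exists_between (mem_ball_zero_iff.1 hz)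
  have hsub : closedBall (0 : ℂ) τ ⊆ ball 0 σ := closedBall_subset_ball hτσ
  have hsub' : ball (0 : ℂ) τ ⊆ ball 0 σ := ball_subset_ball hτσ.le
  have hzτ' : z ∈ ball (0 : ℂ) τ := mem_ball_zero_iff.2 hzτ
  have hdQ := hQ.deriv isOpen_ball
  obtain ⟨C, hC⟩ := ((isCompact_closedBall (0 : ℂ) τ).image_of_continuousOn
    (hdQ.continuousOn.mono hsub)).isBounded.exists_norm_le
  have hcont : ∀ x ∈ ball (0 : ℂ) τ, Continuous fun t : ℝ =>
      Q (x * expCircle (t : UnitAddCircle)) := fun x hx =>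
    hQ.continuousOn.comp_continuous (by fun_prop) fun t => hsub' (mul_expCircle_mem_ball hx _)
  have hcont' : Continuous fun t : ℝ =>
      deriv Q (z * expCircle (t : UnitAddCircle)) * expCircle (t : UnitAddCircle) :=
    (hdQ.continuousOn.comp_continuous (by fun_prop) fun t =>
      hsub' (mul_expCircle_mem_ball hzτ' _)).mul (by fun_prop)
  refine (intervalIntegral.hasDerivAt_integral_of_dominated_loc_of_deriv_le (𝕜 := ℂ)
    (F := fun x t => Q (x * expCircle (t : UnitAddCircle)))
    (F' := fun x t => deriv Q (x * expCircle (t : UnitAddCircle)) * expCircle (t : UnitAddCircle))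
    (bound := fun _ => C) (isOpen_ball.mem_nhds hzτ') ?_ ?_ ?_ ?_ ?_ ?_).2.differentiableAt
  · filter_upwards [isOpen_ball.mem_nhds hzτ'] with x hx
    exact (hcont x hx).aestronglyMeasurable
  · exact (hcont z hzτ').intervalIntegrable _ _
  · exact hcont'.aestronglyMeasurable
  · refine Eventually.of_forall fun t _ x hx => ?_
    rw [norm_mul, norm_expCircle, mul_one]
    exact hC _ (mem_image_of_mem _ (ball_subset_closedBall (mul_expCircle_mem_ball hx _)))
  · exact intervalIntegrable_const
  · refine Eventually.of_forall fun t _ x hx => ?_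
    have h1 : HasDerivAt Q (deriv Q (x * expCircle (t : UnitAddCircle)))
        (x * expCircle (t : UnitAddCircle)) :=
      (hQ.differentiableAt (isOpen_ball.mem_nhds
        (hsub' (mul_expCircle_mem_ball hx _)))).hasDerivAt
    refine HasDerivAt.comp (h₂ := Q) (h := fun x => x * expCircle (t : UnitAddCircle)) x h1 ?_
    simpa using (hasDerivAt_id x).mul_const (expCircle (t : UnitAddCircle))

/-- This normalization makes the mean of `cosh` of a multiple of the defect equal to `cosh 0 = 1`.
-/
lemma arcDefect_zero (hδ : 0 < δ) : arcDefect Q δ 0 = 0 := by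
  have hδ' : (δ : ℂ) ≠ 0 := Complex.ofReal_ne_zero.2 hδ.ne'
  simp only [arcDefect, zero_mul, intervalIntegral.integral_const, sub_neg_eq_add,
    Complex.real_smul]
  push_cast
  field_simp
  ring

lemma arcDefect_expCircle (x : ℝ) :
    arcDefect Q δ (expCircle (x : UnitAddCircle)) = Q (expCircle (x : UnitAddCircle)) -
      (((2 * δ)⁻¹ : ℝ) : ℂ) * ∫ t in -δ..δ, Q (expCircle ((x + t : ℝ) : UnitAddCircle)) := by
  simp only [arcDefect, AddCircle.coe_add, expCircle_add]

lemma continuous_comp_expCircle_coe_add (hσ : 1 < σ) (hQ : DifferentiableOn ℂ Q (ball 0 σ)) (x : ℝ) :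
    Continuous fun t : ℝ => Q (expCircle ((x + t : ℝ) : UnitAddCircle)) :=
  hQ.continuousOn.comp_continuous
    (continuous_expCircle_coe.comp (continuous_const.add continuous_id))
    fun _ => expCircle_mem_ball hσ _

lemma re_arcDefect_expCircle (hσ : 1 < σ) (hQ : DifferentiableOn ℂ Q (ball 0 σ)) (x : ℝ) :
    (arcDefect Q δ (expCircle (x : UnitAddCircle))).re = (Q (expCircle (x : UnitAddCircle))).re -
      (2 * δ)⁻¹ * ∫ t in -δ..δ, (Q (expCircle ((x + t : ℝ) : UnitAddCircle))).re := by
  have hi := (continuous_comp_expCircle_coe_add hσ hQ x).intervalIntegrable (μ := volume) (-δ) δ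
  have h := Complex.reCLM.intervalIntegral_comp_comm hi
  simp only [Complex.reCLM_apply] at h
  rw [arcDefect_expCircle, Complex.sub_re, Complex.re_ofReal_mul, h]

lemma im_arcDefect_expCircle (hσ : 1 < σ) (hQ : DifferentiableOn ℂ Q (ball 0 σ)) (x : ℝ) :
    (arcDefect Q δ (expCircle (x : UnitAddCircle))).im = (Q (expCircle (x : UnitAddCircle))).im -
      (2 * δ)⁻¹ * ∫ t in -δ..δ, (Q (expCircle ((x + t : ℝ) : UnitAddCircle))).im := by
  have hi := (continuous_comp_expCircle_coe_add hσ hQ x).intervalIntegrable (μ := volume) (-δ) δ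
  have h := Complex.imCLM.intervalIntegral_comp_comm hi
  simp only [Complex.imCLM_apply] at h
  rw [arcDefect_expCircle, Complex.sub_im, Complex.im_ofReal_mul, h]

/-- Deviation from arc averages for a function that is monotone up to a linear term and has
controlled increments. -/
lemma abs_sub_average_le {F : ℝ → ℝ} (hF : Continuous F) {κ A : ℝ} (hδ : 0 < δ)
    (hmono : Monotone fun t => F t + κ * t)
    (hinc : ∀ t, (F (t + δ) + κ * (t + δ)) - (F t + κ * t) ≤ 2 * A) (x : ℝ) :
    |F x - (2 * δ)⁻¹ * ∫ t in -δ..δ, F (x + t)| ≤ A := by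
  set M : ℝ → ℝ := fun t => F t + κ * t with hM
  have hMc : Continuous M := by fun_prop
  have hi : ∀ a b : ℝ, IntervalIntegrable (fun t => M (x + t) - M x) volume a b := fun a b =>
    Continuous.intervalIntegrable (by fun_prop) _ _
  -- The linear term has average zero over the symmetric interval, so `F` may be replaced by the
  -- monotone `M`.
  have h1 : F x - (2 * δ)⁻¹ * ∫ t in -δ..δ, F (x + t) =
      -((2 * δ)⁻¹ * ∫ t in -δ..δ, (M (x + t) - M x)) := by
    have h2 : ∀ t, M (x + t) - M x = F (x + t) + (κ * t - F x) := fun t => by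
      simp only [hM]; ring
    simp_rw [h2]
    rw [intervalIntegral.integral_add (Continuous.intervalIntegrable (by fun_prop) _ _)
      (Continuous.intervalIntegrable (by fun_prop) _ _),
      intervalIntegral.integral_sub (Continuous.intervalIntegrable (by fun_prop) _ _)
      (Continuous.intervalIntegrable (by fun_prop) _ _), intervalIntegral.integral_const_mul,
      integral_id, intervalIntegral.integral_const, smul_eq_mul]
    field_simp
    ring
  -- The two halves have opposite signs and each is at most `2Aδ` in absolute value. They do not add
  -- up, so dividing by `2δ` gives `A`.
  have h3 : ∫ t in -δ..δ, (M (x + t) - M x) =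
      (∫ t in -δ..0, (M (x + t) - M x)) + ∫ t in (0)..δ, (M (x + t) - M x) :=
    (intervalIntegral.integral_add_adjacent_intervals (hi _ _) (hi _ _)).symm
  have h4 : 0 ≤ ∫ t in (0)..δ, (M (x + t) - M x) :=
    intervalIntegral.integral_nonneg hδ.le fun t ht => sub_nonneg.2 (hmono (by linarith [ht.1]))
  have h5 : ∫ t in (0)..δ, (M (x + t) - M x) ≤ ∫ _ in (0)..δ, 2 * A := by
    refine intervalIntegral.integral_mono_on hδ.le (hi _ _) intervalIntegrable_const fun t ht => ?_
    have h6 : M (x + t) ≤ M (x + δ) := hmono (by linarith [ht.2])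
    have h7 := hinc x
    simp only [hM] at h6 ⊢
    linarith
  have h8 : ∫ t in -δ..0, (M (x + t) - M x) ≤ ∫ _ in -δ..0, (0 : ℝ) := by
    refine intervalIntegral.integral_mono_on (by linarith) (hi _ _) intervalIntegrable_const
      fun t ht => sub_nonpos.2 (hmono (by linarith [ht.2]))
  have h9 : ∫ _ in -δ..0, -(2 * A) ≤ ∫ t in -δ..0, (M (x + t) - M x) := by
    refine intervalIntegral.integral_mono_on (by linarith) intervalIntegrable_const (hi _ _)
      fun t ht => ?_
    have h6 : M (x - δ) ≤ M (x + t) := hmono (by linarith [ht.1])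
    have h7 := hinc (x - δ)
    simp only [sub_add_cancel, hM] at h6 h7 ⊢
    linarith
  simp only [intervalIntegral.integral_const, smul_eq_mul] at h5 h8 h9
  rw [h1, abs_neg, abs_mul, abs_of_pos (by positivity), inv_mul_le_iff₀ (by positivity), h3, abs_le]
  constructor <;> linarith

/-- Exponential integrability for the real part of an analytic function with bounded imaginary
part. -/
lemma integral_cosh_le (hσ : 1 < σ) (hQ : DifferentiableOn ℂ Q (ball 0 σ)) (h0 : Q 0 = 0) {α A : ℝ}
    (hA : 0 < A) (hα : 0 ≤ α) (hα2 : α < π / 2) (him : ∀ x, |(Q (expCircle x)).im| ≤ A) :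
    ∫ x, Real.cosh (α / A * (Q (expCircle x)).re) ≤ (Real.cos α)⁻¹ := by
  have hcos : 0 < Real.cos α := Real.cos_pos_of_mem_Ioo ⟨by linarith, hα2⟩
  have hQc : Continuous fun x => Q (expCircle x) :=
    hQ.continuousOn.comp_continuous continuous_expCircle (expCircle_mem_ball hσ)
  have hf : DifferentiableOn ℂ (fun z => Complex.cosh (((α / A : ℝ) : ℂ) * Q z)) (ball 0 σ) :=
    (hQ.const_mul _).ccosh
  have hf' : DiffContOnCl ℂ (fun z => Complex.cosh (((α / A : ℝ) : ℂ) * Q z)) (ball 0 |1|) := by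
    refine DifferentiableOn.diffContOnCl (hf.mono ?_)
    rw [abs_one]
    exact closure_ball_subset_closedBall.trans (closedBall_subset_ball hσ)
  have h1 := hf'.circleAverage
  rw [← integral_comp_expCircle, h0, mul_zero, Complex.cosh_zero] at h1
  have hc : Continuous fun x => Complex.cosh (((α / A : ℝ) : ℂ) * Q (expCircle x)) :=
    Complex.continuous_cosh.comp (continuous_const.mul hQc)
  -- This is the real part of the mean value formula, as `Re cosh (a + ib) = cosh a cos b`. The
  -- bound on the imaginary part keeps the cosine at least `cos α`, which can then be divided out.
  have h2 : ∫ x, Real.cosh (α / A * (Q (expCircle x)).re) *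
      Real.cos (α / A * (Q (expCircle x)).im) = 1 := by
    have h3 := Complex.reCLM.integral_comp_comm (μ := volume)
      (hc.integrable_of_hasCompactSupport (HasCompactSupport.of_compactSpace _))
    rw [h1] at h3
    simp only [Complex.reCLM_apply, Complex.one_re] at h3
    refine Eq.trans ?_ h3
    refine integral_congr_ae (Eventually.of_forall fun x => ?_)
    simp only
    set q := Q (expCircle x)
    have h4 : ((α / A : ℝ) : ℂ) * q = ((α / A * q.re : ℝ) : ℂ) +
        ((α / A * q.im : ℝ) : ℂ) * Complex.I := by
      conv_lhs => rw [← Complex.re_add_im q]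
      push_cast; ring
    rw [h4]
    generalize α / A * q.re = a
    generalize α / A * q.im = b
    rw [Complex.cosh_add, Complex.cosh_mul_I, Complex.sinh_mul_I, ← Complex.ofReal_cosh,
      ← Complex.ofReal_cos, ← Complex.ofReal_sinh, ← Complex.ofReal_sin]
    simp only [Complex.add_re, Complex.mul_re, Complex.mul_im, Complex.ofReal_re, Complex.ofReal_im,
      Complex.I_re, Complex.I_im]
    ring
  have hre : Continuous fun x => (Q (expCircle x)).re := Complex.continuous_re.comp hQc
  have him' : Continuous fun x => (Q (expCircle x)).im := Complex.continuous_im.comp hQc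
  have hcosh : Continuous fun x => Real.cosh (α / A * (Q (expCircle x)).re) :=
    Real.continuous_cosh.comp (continuous_const.mul hre)
  have hcosc : Continuous fun x => Real.cos (α / A * (Q (expCircle x)).im) :=
    Real.continuous_cos.comp (continuous_const.mul him')
  have hone : 0 < ∫ x, Real.cosh (α / A * (Q (expCircle x)).re) := by
    refine one_pos.trans_le ?_
    calc (1 : ℝ) = ∫ _ : UnitAddCircle, (1 : ℝ) := by simp [measureReal_def]
      _ ≤ _ := integral_mono (integrable_const _) (Continuous.integrable_circle hcosh)
          fun x => Real.one_le_cosh _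
  rw [le_inv_comm₀ hone hcos, ← one_div, le_div_iff₀ hone, ← integral_const_mul]
  refine le_trans ?_ h2.le
  refine integral_mono (Continuous.integrable_circle (continuous_const.mul hcosh))
    (Continuous.integrable_circle (hcosh.mul hcosc)) fun x => ?_
  simp only
  rw [mul_comm]
  refine mul_le_mul_of_nonneg_left ?_ (Real.cosh_pos _).le
  rw [← Real.cos_abs (α / A * _)]
  have h5 : |α / A * (Q (expCircle x)).im| ≤ α := by
    rw [abs_mul, abs_of_nonneg (by positivity)]
    calc α / A * |(Q (expCircle x)).im| ≤ α / A * A := by gcongr; exact him x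
      _ = α := by field_simp
  exact Real.cos_le_cos_of_nonneg_of_le_pi (abs_nonneg _) (by linarith [Real.pi_pos]) h5

/-- Exponential integrability of `Re Q` on the unit circle, given an upper bound for its radial
derivative on the circle and bounds for arc averages. -/
lemma integral_exp_abs_re_le (hσ : 1 < σ) (hQ : DifferentiableOn ℂ Q (ball 0 σ))
    {κ r D A G α : ℝ} (hδ : 0 < δ) (hr : 1 - r = π * δ) (hr0 : 0 < r)
    (hκ : ∀ z : ℂ, ‖z‖ = 1 → 2 * π * (z * deriv Q z).re ≤ κ)
    (hD : ∀ z : ℂ, ‖z‖ = r → -(2 * π * (z * deriv Q z).re) ≤ D)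
    (hG : ∀ x : ℝ, |∫ t in -δ..δ, (Q (expCircle ((x + t : ℝ) : UnitAddCircle))).re| ≤ 2 * δ * G)
    (hA : 0 < A) (hAD : (1 - r) / (1 + r) * (κ + D) ≤ A) (hα : 0 ≤ α) (hα2 : α < π / 2) :
    ∫ x, Real.exp (α / A * |(Q (expCircle x)).re|) ≤ 2 * Real.exp (α / A * G) / Real.cos α := by
  have hder : ∀ t : ℝ, HasDerivAt (fun t : ℝ => -(Q (expCircle (t : UnitAddCircle))).im + κ * t)
      (κ - 2 * π * (expCircle (t : UnitAddCircle) * deriv Q (expCircle (t : UnitAddCircle))).re) t :=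
    fun t => by
    have h := (hasDerivAt_im_comp_expCircle hσ hQ t).neg.add ((hasDerivAt_id t).const_mul κ)
    refine h.congr_deriv ?_
    ring
  have hmono : Monotone fun t : ℝ => -(Q (expCircle (t : UnitAddCircle))).im + κ * t :=
    monotone_of_hasDerivAt_nonneg hder fun t => sub_nonneg.2 (hκ _ (norm_expCircle _))
  have hFc : Continuous fun t : ℝ => -(Q (expCircle (t : UnitAddCircle))).im :=
    (Complex.continuous_im.comp (hQ.continuousOn.comp_continuous continuous_expCircle_coe
      fun t => expCircle_mem_ball hσ _)).neg
  have him : ∀ x, |(arcDefect Q δ (expCircle x)).im| ≤ A := by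
    intro x
    obtain ⟨x, rfl⟩ := QuotientAddGroup.mk_surjective x
    have h1 := abs_sub_average_le hFc hδ hmono
      (fun t => (increment_le hσ hQ hδ hr hr0 hκ hD t).trans
        (mul_le_mul_of_nonneg_left hAD two_pos.le)) x
    have h2 := im_arcDefect_expCircle (δ := δ) hσ hQ x
    rw [intervalIntegral.integral_neg, mul_neg, sub_neg_eq_add, ← abs_neg, neg_add, neg_neg,
      ← sub_eq_add_neg, ← h2] at h1
    exact h1
  have hcosh := integral_cosh_le hσ (differentiableOn_arcDefect (δ := δ) hQ) (arcDefect_zero hδ) hA hα hα2 him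
  have hdc : Continuous fun x => (arcDefect Q δ (expCircle x)).re :=
    Complex.continuous_re.comp ((differentiableOn_arcDefect hQ).continuousOn.comp_continuous
      continuous_expCircle (expCircle_mem_ball hσ))
  have hQc : Continuous fun x => (Q (expCircle x)).re :=
    Complex.continuous_re.comp
      (hQ.continuousOn.comp_continuous continuous_expCircle (expCircle_mem_ball hσ))
  have hpt : ∀ x, Real.exp (α / A * |(Q (expCircle x)).re|) ≤
      2 * Real.exp (α / A * G) * Real.cosh (α / A * (arcDefect Q δ (expCircle x)).re) := by
    intro x
    have h1 : |(Q (expCircle x)).re| ≤ |(arcDefect Q δ (expCircle x)).re| + G := by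
      obtain ⟨x, rfl⟩ := QuotientAddGroup.mk_surjective x
      have h2 := re_arcDefect_expCircle (δ := δ) hσ hQ x
      have h3 : |(2 * δ)⁻¹ * ∫ t in -δ..δ, (Q (expCircle ((x + t : ℝ) : UnitAddCircle))).re| ≤ G := by
        rw [abs_mul, abs_of_pos (by positivity), inv_mul_le_iff₀ (by positivity)]
        exact hG x
      have h4 : (Q (expCircle (x : UnitAddCircle))).re =
          (arcDefect Q δ (expCircle (x : UnitAddCircle))).re +
          (2 * δ)⁻¹ * ∫ t in -δ..δ, (Q (expCircle ((x + t : ℝ) : UnitAddCircle))).re := by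
        rw [h2]; ring
      change |(Q (expCircle (x : UnitAddCircle))).re| ≤ |(arcDefect Q δ (expCircle (x : UnitAddCircle))).re| + G
      rw [h4]
      exact (abs_add_le _ _).trans (add_le_add le_rfl h3)
    set b := (arcDefect Q δ (expCircle x)).re
    have h5 : Real.exp (α / A * |b|) ≤ 2 * Real.cosh (α / A * b) := by
      rw [← Real.cosh_abs, abs_mul, abs_of_nonneg (by positivity : 0 ≤ α / A), Real.cosh_eq]
      have := Real.exp_pos (-(α / A * |b|))
      linarith
    calc Real.exp (α / A * |(Q (expCircle x)).re|) ≤ Real.exp (α / A * (|b| + G)) := by gcongr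
      _ = Real.exp (α / A * G) * Real.exp (α / A * |b|) := by rw [← Real.exp_add]; congr 1; ring
      _ ≤ Real.exp (α / A * G) * (2 * Real.cosh (α / A * b)) := by gcongr
      _ = _ := by ring
  calc ∫ x, Real.exp (α / A * |(Q (expCircle x)).re|)
      ≤ ∫ x, 2 * Real.exp (α / A * G) * Real.cosh (α / A * (arcDefect Q δ (expCircle x)).re) :=
        integral_mono (Continuous.integrable_circle (by fun_prop))
          (Continuous.integrable_circle
            (continuous_const.mul (Real.continuous_cosh.comp (continuous_const.mul hdc)))) hpt
    _ = 2 * Real.exp (α / A * G) * ∫ x, Real.cosh (α / A * (arcDefect Q δ (expCircle x)).re) :=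
        integral_const_mul _ _
    _ ≤ 2 * Real.exp (α / A * G) * (Real.cos α)⁻¹ := by gcongr
    _ = _ := (div_eq_mul_inv _ _).symm

end

/-! ### Estimates for the dilated extension and passage to the boundary. -/

lemma norm_ofReal_mul_lt_one {s : ℝ} (hs : 0 < s) {z : ℂ} (hz : z ∈ ball (0 : ℂ) s⁻¹) :
    ‖(s : ℂ) * z‖ < 1 := by
  rw [mem_ball_zero_iff] at hz
  rw [norm_mul, Complex.norm_real, Real.norm_of_nonneg hs.le]
  calc s * ‖z‖ < s * s⁻¹ := by gcongr
    _ = 1 := mul_inv_cancel₀ hs.ne'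

lemma hasDerivAt_herglotzIntegral_mul {g : ℂ → ℝ} (hg : Integrable fun x => g (expCircle x)) {s : ℝ}
    (hs : 0 < s) {z : ℂ} (hz : z ∈ ball (0 : ℂ) s⁻¹) :
    HasDerivAt (fun z => herglotzIntegral g (s * z))
      ((∫ x, (2 * expCircle x / (expCircle x - s * z) ^ 2) * (g (expCircle x) : ℂ)) * s) z := by
  refine HasDerivAt.comp (h₂ := herglotzIntegral g) (h := fun z => (s : ℂ) * z) z
    (hasDerivAt_herglotzIntegral hg (norm_ofReal_mul_lt_one hs hz)) ?_
  simpa using (hasDerivAt_id z).const_mul (s : ℂ)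

lemma differentiableOn_herglotzIntegral_mul {g : ℂ → ℝ} (hg : Integrable fun x => g (expCircle x))
    {s : ℝ} (hs : 0 < s) :
    DifferentiableOn ℂ (fun z => herglotzIntegral g (s * z)) (ball 0 s⁻¹) := fun _ hz =>
  (hasDerivAt_herglotzIntegral_mul hg hs hz).differentiableAt.differentiableWithinAt

lemma re_herglotzIntegral_mul_expCircle {g : ℂ → ℝ} (hg : Integrable fun x => g (expCircle x))
    {s : ℝ} (hs : 0 ≤ s) (hs1 : s < 1) (x : UnitAddCircle) :
    (herglotzIntegral g (s * expCircle x)).re = poissonAverage s (fun y => g (expCircle y)) x := by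
  rw [re_herglotzIntegral hg]
  · simp only [poissonKernel_mul_expCircle]
    rfl
  · rw [norm_mul, norm_expCircle, mul_one]
    exact norm_ofReal_lt_one hs hs1

/-- A lower bound for the radial derivative of the dilated Poisson extension of a nonnegative
superharmonic function. -/
lemma IsNonnegSuperharmonicOn.neg_le_re_mul_deriv_herglotzIntegral {w : ℂ → ℝ≥0∞} {R : ℝ}
    (hw : IsNonnegSuperharmonicOn w (ball 0 R)) {ρ : ℝ} (hρ : 1 < ρ) (hρR : ρ < R) {g : ℂ → ℝ}
    (hg : Integrable fun x => g (expCircle x)) (hg0 : ∀ z, 0 ≤ g z)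
    (hwg : ∀ᵐ x, w (expCircle x) = ENNReal.ofReal (g (expCircle x))) {s : ℝ} (hs : 0 < s)
    (hs1 : s < 1) {z : ℂ} (hz : ‖z‖ = 1) :
    -((∫ x, g (expCircle x)) * ((ρ + 1) / (ρ - 1)) / Real.log ρ) / 2 ≤
      (z * deriv (fun z => herglotzIntegral g (s * z)) z).re := by
  have hsn := norm_ofReal_lt_one hs.le hs1
  -- Rotation averages of `w` with this weight agree on the unit circle with the real part of the
  -- dilated Herglotz integral of `g`.
  set p : UnitAddCircle → ℝ≥0∞ := fun y => ENNReal.ofReal (poissonKernel 0 s (expCircle y)) with hp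
  have hpm : Measurable p :=
    (ENNReal.continuous_ofReal.comp (continuous_poissonKernel_expCircle hsn)).measurable
  have hpos : ∀ x, 0 ≤ poissonAverage s (fun y => g (expCircle y)) x := fun x =>
    integral_nonneg fun y => mul_nonneg (poissonKernel_expCircle_nonneg hsn _) (hg0 _)
  refine (hw.rotationAverage hpm).neg_le_re_mul_deriv hρ hρR (one_lt_inv₀ hs |>.2 hs1)
    (differentiableOn_herglotzIntegral_mul hg hs) ?_ ?_ ?_ hz
  · intro z hz
    obtain ⟨x, rfl⟩ := exists_expCircle_eq hz
    rw [re_herglotzIntegral_mul_expCircle hg hs.le hs1, poissonAverage,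
      ofReal_integral_eq_lintegral_ofReal (integrable_poissonKernel_smul hs.le hs1 hg x)
        (Eventually.of_forall fun y => mul_nonneg (poissonKernel_expCircle_nonneg hsn _) (hg0 _)),
      SubharmonicSplitting.rotationAverage]
    rw [← lintegral_sub_right_eq_self (fun y => w (expCircle x * expCircle y) * p y) x]
    refine lintegral_congr_ae ?_
    filter_upwards [hwg] with y hy
    rw [← expCircle_add, add_sub_cancel, hy, mul_comm, hp, smul_eq_mul,
      ENNReal.ofReal_mul (poissonKernel_expCircle_nonneg hsn _)]
  · intro z hz
    obtain ⟨x, rfl⟩ := exists_expCircle_eq hz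
    rw [re_herglotzIntegral_mul_expCircle hg hs.le hs1]
    exact hpos x
  · intro z hz
    have hn : ‖(s : ℂ) * z‖ = s * ρ⁻¹ := by
      rw [norm_mul, Complex.norm_real, Real.norm_of_nonneg hs.le, hz]
    have hρ0 : 0 < ρ := by linarith
    have hρi : ρ⁻¹ < 1 := inv_lt_one_of_one_lt₀ hρ
    have hle : s * ρ⁻¹ ≤ ρ⁻¹ := mul_le_of_le_one_left (by positivity) hs1.le
    have hn1 : ‖(s : ℂ) * z‖ < 1 := by rw [hn]; linarith
    -- On `|z| = ρ⁻¹` the Poisson kernel is bounded, so the extension there is at most this constant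
    -- times the mean of `g`.
    have hPle : ∀ x, poissonKernel 0 (s * z) (expCircle x) ≤ (ρ + 1) / (ρ - 1) := fun x => by
      refine (poissonKernel_expCircle_le hn1 x).trans ?_
      rw [hn, div_le_div_iff₀ (by linarith) (by linarith)]
      have : s * ρ⁻¹ * ρ ≤ 1 := by
        rw [mul_assoc, inv_mul_cancel₀ hρ0.ne', mul_one]; exact hs1.le
      nlinarith
    rw [re_herglotzIntegral hg hn1, mul_comm (∫ x, g (expCircle x)), ← integral_const_mul]
    refine integral_mono_of_nonneg (Eventually.of_forall fun x =>
      mul_nonneg (poissonKernel_expCircle_nonneg hn1 _) (hg0 _)) (hg.const_mul _)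
      (Eventually.of_forall fun x => mul_le_mul_of_nonneg_right (hPle x) (hg0 _))

/-- A bound for the radial derivative of the Herglotz integral in the interior. -/
lemma norm_mul_integral_le {q : ℂ → ℝ} {v₀ v₁ : UnitAddCircle → ℝ} {ε₀ ε₁ t : ℝ}
    (hq : ∀ᵐ x, q (expCircle x) = v₁ x + v₀ x) (hv₁ : Integrable v₁) (hε₁ : ∫ x, |v₁ x| ≤ ε₁)
    (hε₀ : ∀ᵐ x, |v₀ x| ≤ ε₀) {ξ : ℂ} (hξ : ‖ξ‖ = t) (ht1 : t < 1) :
    ‖ξ * ∫ x, (2 * expCircle x / (expCircle x - ξ) ^ 2) * (q (expCircle x) : ℂ)‖ ≤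
      2 * (ε₀ * (t / (1 - t ^ 2)) + ε₁ * (t / (1 - t) ^ 2)) := by
  have ht0 : 0 ≤ t := hξ ▸ norm_nonneg ξ
  have hξ1 : ‖ξ‖ < 1 := by rwa [hξ]
  have h1t : 0 < 1 - t := by linarith
  have h1t2 : 0 < 1 - t ^ 2 := by nlinarith
  -- The kernel has size `2 / |e(x) - ξ|²`. For the bounded part `v₀` it is kept as a multiple of
  -- the Poisson kernel, whose integral is `1`; for the integrable part `v₁` it is replaced by its
  -- supremum.
  have hpt : ∀ᵐ x, ‖(2 * expCircle x / (expCircle x - ξ) ^ 2) * (q (expCircle x) : ℂ)‖ ≤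
      2 * ε₀ / (1 - t ^ 2) * poissonKernel 0 ξ (expCircle x) + 2 / (1 - t) ^ 2 * |v₁ x| := by
    filter_upwards [hq, hε₀] with x hx hx0
    have hd : 1 - t ≤ ‖expCircle x - ξ‖ := by
      have := norm_sub_norm_le (expCircle x) ξ
      rwa [norm_expCircle, hξ] at this
    have hd0 : 0 < ‖expCircle x - ξ‖ := h1t.trans_le hd
    rw [norm_mul, norm_div, norm_mul, norm_expCircle, norm_pow, Complex.norm_real,
      Real.norm_eq_abs, poissonKernel_expCircle, hξ, hx, Complex.norm_two, mul_one]
    calc 2 / ‖expCircle x - ξ‖ ^ 2 * |v₁ x + v₀ x|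
        ≤ 2 / ‖expCircle x - ξ‖ ^ 2 * (|v₁ x| + ε₀) := by
          gcongr
          exact (abs_add_le _ _).trans (add_le_add le_rfl hx0)
      _ = 2 * ε₀ / (1 - t ^ 2) * ((1 - t ^ 2) / ‖expCircle x - ξ‖ ^ 2) +
          2 / ‖expCircle x - ξ‖ ^ 2 * |v₁ x| := by field_simp; ring
      _ ≤ _ := by gcongr
  have hi1 : Integrable fun x => 2 * ε₀ / (1 - t ^ 2) * poissonKernel 0 ξ (expCircle x) :=
    Continuous.integrable_circle (continuous_const.mul (continuous_poissonKernel_expCircle hξ1))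
  have hi2 : Integrable fun x => 2 / (1 - t) ^ 2 * |v₁ x| := hv₁.abs.const_mul _
  rw [norm_mul, hξ]
  calc t * ‖∫ x, (2 * expCircle x / (expCircle x - ξ) ^ 2) * (q (expCircle x) : ℂ)‖
      ≤ t * ∫ x, (2 * ε₀ / (1 - t ^ 2) * poissonKernel 0 ξ (expCircle x) +
          2 / (1 - t) ^ 2 * |v₁ x|) := by
        gcongr
        exact norm_integral_le_of_norm_le (hi1.add hi2) hpt
    _ = t * (2 * ε₀ / (1 - t ^ 2) + 2 / (1 - t) ^ 2 * ∫ x, |v₁ x|) := by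
        rw [integral_add hi1 hi2, integral_const_mul, integral_const_mul,
          integral_poissonKernel hξ1, mul_one]
    _ ≤ t * (2 * ε₀ / (1 - t ^ 2) + 2 / (1 - t) ^ 2 * ε₁) := by gcongr
    _ = _ := by ring

/-- A bound for arc averages of Poisson averages. -/
lemma abs_integral_poissonAverage_le {q : UnitAddCircle → ℝ} {v₀ v₁ : UnitAddCircle → ℝ}
    {ε₀ ε₁ δ s : ℝ} (hs : 0 ≤ s) (hs1 : s < 1)
    (hq : ∀ᵐ x, q x = v₁ x + v₀ x) (hqi : Integrable q) (hv₁ : Integrable v₁)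
    (hε₁ : ∫ x, |v₁ x| ≤ ε₁) (hε₀ : ∀ᵐ x, |v₀ x| ≤ ε₀) (hδ : 0 < δ) (hδ2 : 2 * δ ≤ 1) (x : ℝ) :
    |∫ t in -δ..δ, poissonAverage s q ((x + t : ℝ) : UnitAddCircle)| ≤ 2 * δ * ε₀ + ε₁ := by
  have hc1 : Continuous (poissonAverage s fun y => |v₁ y|) :=
    continuous_poissonAverage hs hs1 hv₁.abs
  have hpt : ∀ y, ‖poissonAverage s q y‖ ≤ poissonAverage s (fun y => |v₁ y|) y + ε₀ := by
    intro y
    have h1 : poissonAverage s (fun y => |q y| - |v₁ y|) y ≤ ε₀ := by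
      refine poissonAverage_le_of_le hs hs1 (hqi.abs.sub hv₁.abs) ?_ y
      filter_upwards [hq, hε₀] with z hz hz0
      change |q z| - |v₁ z| ≤ ε₀
      rw [hz]
      have := abs_add_le (v₁ z) (v₀ z)
      linarith
    rw [poissonAverage_sub hs hs1 hqi.abs hv₁.abs] at h1
    have h2 := norm_poissonAverage_le hs hs1 q y
    simp only [Real.norm_eq_abs] at h2 ⊢
    linarith
  have hcR : Continuous fun t : ℝ => poissonAverage s (fun y => |v₁ y|) ((x + t : ℝ) : UnitAddCircle) :=
    hc1.comp ((AddCircle.continuous_mk' 1).comp (continuous_const.add continuous_id))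
  have h0 : ∀ y, 0 ≤ poissonAverage s (fun y => |v₁ y|) y := fun y =>
    integral_nonneg fun z => mul_nonneg
      (poissonKernel_expCircle_nonneg (norm_ofReal_lt_one hs hs1) _) (abs_nonneg _)
  rw [← Real.norm_eq_abs]
  calc ‖∫ t in -δ..δ, poissonAverage s q ((x + t : ℝ) : UnitAddCircle)‖
      ≤ ∫ t in -δ..δ, (poissonAverage s (fun y => |v₁ y|) ((x + t : ℝ) : UnitAddCircle) + ε₀) :=
        intervalIntegral.norm_integral_le_of_norm_le (by linarith)
          (Eventually.of_forall fun t _ => hpt _)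
          ((hcR.add continuous_const).intervalIntegrable _ _)
    _ = (∫ t in -δ..δ, poissonAverage s (fun y => |v₁ y|) ((x + t : ℝ) : UnitAddCircle)) +
          2 * δ * ε₀ := by
        rw [intervalIntegral.integral_add (hcR.intervalIntegrable _ _) intervalIntegrable_const,
          intervalIntegral.integral_const, smul_eq_mul]
        ring
    _ ≤ (∫ t in -δ..-δ + 1, poissonAverage s (fun y => |v₁ y|) ((x + t : ℝ) : UnitAddCircle)) +
          2 * δ * ε₀ := by
        gcongr
        exact intervalIntegral.integral_mono_interval le_rfl (by linarith) (by linarith)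
          (Eventually.of_forall fun t => h0 _) (hcR.intervalIntegrable _ _)
    _ = (∫ y, poissonAverage s (fun y => |v₁ y|) y) + 2 * δ * ε₀ := by
        have h3 := UnitAddCircle.intervalIntegral_preimage (-δ)
          (fun y => poissonAverage s (fun y => |v₁ y|) ((x : UnitAddCircle) + y))
        simp only [AddCircle.coe_add]
        rw [h3, integral_add_left_eq_self]
    _ ≤ 2 * δ * ε₀ + ε₁ := by
        rw [integral_poissonAverage hs hs1 hv₁.abs]
        linarith

/-- Poisson averages converge almost everywhere along a sequence of radii. -/
lemma exists_seq_tendsto_poissonAverage {q : UnitAddCircle → ℝ} (hq : Integrable q) :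
    ∃ s : ℕ → ℝ, (∀ n, s n ∈ Ioo (0 : ℝ) 1) ∧
      ∀ᵐ x, Tendsto (fun n => poissonAverage (s n) q x) atTop (𝓝 (q x)) := by
  -- The shift by `2` keeps every radius, including the first, strictly between `0` and `1`.
  set u : ℕ → ℝ := fun n => 1 - 1 / ((n : ℝ) + 2) with hu
  have hu01 : ∀ n, u n ∈ Ioo (0 : ℝ) 1 := fun n => by
    have h2 : (1 : ℝ) < (n : ℝ) + 2 := by
      have : (0 : ℝ) ≤ n := n.cast_nonneg
      linarith
    have h3 : 1 / ((n : ℝ) + 2) < 1 := by rw [div_lt_one (by linarith)]; exact h2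
    have h4 : 0 < 1 / ((n : ℝ) + 2) := by positivity
    constructor <;> simp only [hu] <;> linarith
  have hulim : Tendsto u atTop (𝓝[<] 1) := by
    refine tendsto_nhdsWithin_iff.2 ⟨?_, Eventually.of_forall fun n => (hu01 n).2⟩
    have h1 : Tendsto (fun n : ℕ => 1 / ((n : ℝ) + 2)) atTop (𝓝 0) := by
      have := (tendsto_natCast_atTop_atTop (R := ℝ)).atTop_add (tendsto_const_nhds (x := (2 : ℝ)))
      simp only [one_div]
      exact this.inv_tendsto_atTop
    have h2 := (tendsto_const_nhds (x := (1 : ℝ))).sub h1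
    rwa [sub_zero] at h2
  have hofReal : ∀ s x, poissonAverage s (fun y => (q y : ℂ)) x =
      ((poissonAverage s q x : ℝ) : ℂ) := by
    intro s x
    simp only [poissonAverage]
    rw [← integral_complex_ofReal]
    simp
  have hL1 := (tendsto_integral_norm_poissonAverage_sub hq.ofReal).comp hulim
  have hci : ∀ n, Integrable (poissonAverage (u n) q) := fun n =>
    Continuous.integrable_circle (continuous_poissonAverage (hu01 n).1.le (hu01 n).2 hq)
  have hmeas : TendstoInMeasure volume (fun n => poissonAverage (u n) q) atTop q := by
    refine tendstoInMeasure_of_tendsto_eLpNorm one_ne_zero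
      (fun n => (hci n).aestronglyMeasurable) hq.aestronglyMeasurable ?_
    have h1 : ∀ n, eLpNorm (poissonAverage (u n) q - q) 1 volume =
        ENNReal.ofReal (∫ x, ‖poissonAverage (u n) (fun y => (q y : ℂ)) x - (q x : ℂ)‖) := fun n => by
      rw [eLpNorm_one_eq_lintegral_enorm, ← ofReal_integral_norm_eq_lintegral_enorm ((hci n).sub hq)]
      congr 2
      ext x
      rw [hofReal, ← Complex.ofReal_sub, Complex.norm_real]
      rfl
    simp_rw [h1]
    have := ENNReal.tendsto_ofReal hL1
    simpa using this
  obtain ⟨ns, -, hns⟩ := hmeas.exists_seq_tendsto_ae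
  exact ⟨fun n => u (ns n), fun n => hu01 _, hns⟩

/-- A bound for the radial derivative of the dilated Poisson extension in the interior. -/
lemma neg_re_mul_deriv_herglotzIntegral_le {q : ℂ → ℝ}
    (hqi : Integrable fun x => q (expCircle x)) {ε₀ ε₁ r s : ℝ} {v₀ v₁ : UnitAddCircle → ℝ}
    (hq : ∀ᵐ x, q (expCircle x) = v₁ x + v₀ x) (hv₁ : Integrable v₁)
    (hε₁ : ∫ x, |v₁ x| ≤ ε₁) (hε₀ : ∀ᵐ x, |v₀ x| ≤ ε₀) (hε₁0 : 0 ≤ ε₁) (hε₀0 : 0 ≤ ε₀)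
    (hr0 : 0 < r) (hr1 : r < 1) (hs : 0 < s) (hs1 : s < 1) {z : ℂ} (hz : ‖z‖ = r) :
    -(2 * π * (z * deriv (fun z => herglotzIntegral q (s * z)) z).re) ≤
      4 * π * (ε₀ * (r / (1 - r ^ 2)) + ε₁ * (r / (1 - r) ^ 2)) := by
  have hzb : z ∈ ball (0 : ℂ) s⁻¹ := by
    rw [mem_ball_zero_iff, hz]; exact hr1.trans ((one_lt_inv₀ hs).2 hs1)
  have htr : s * r ≤ r := mul_le_of_le_one_left hr0.le hs1.le
  have ht0 : 0 ≤ s * r := mul_nonneg hs.le hr0.le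
  have hn : ‖(s : ℂ) * z‖ = s * r := by
    rw [norm_mul, Complex.norm_real, Real.norm_of_nonneg hs.le, hz]
  have h1 := norm_mul_integral_le hq hv₁ hε₁ hε₀ hn (htr.trans_lt hr1)
  have h6 := (hasDerivAt_herglotzIntegral_mul hqi hs hzb).deriv
  rw [h6]
  generalize (∫ x, (2 * expCircle x / (expCircle x - s * z) ^ 2) * (q (expCircle x) : ℂ)) = J
    at h1 ⊢
  generalize s * r = t at *
  have h0 : z * (J * s) = s * z * J := by ring
  rw [h0]
  have h2 : -(s * z * J).re ≤ ‖(s : ℂ) * z * J‖ :=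
    (neg_le_abs _).trans (Complex.abs_re_le_norm _)
  have h3 : t / (1 - t ^ 2) ≤ r / (1 - r ^ 2) :=
    div_le_div₀ hr0.le htr (by nlinarith) (by nlinarith)
  have h4 : t / (1 - t) ^ 2 ≤ r / (1 - r) ^ 2 := by
    refine div_le_div₀ hr0.le htr (pow_pos (by linarith) 2) ?_
    exact pow_le_pow_left₀ (by linarith) (by linarith) 2
  have h5 : ‖(s : ℂ) * z * J‖ ≤ 2 * (ε₀ * (r / (1 - r ^ 2)) + ε₁ * (r / (1 - r) ^ 2)) :=
    h1.trans (by gcongr)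
  have h7 := h2.trans h5
  have h8 := mul_le_mul_of_nonneg_left h7 (by positivity : 0 ≤ 2 * π)
  linarith

/-- Exponential integrability of the boundary values `b - g` when `g` are the boundary values of
a nonnegative superharmonic function. -/
theorem IsNonnegSuperharmonicOn.lintegral_exp_abs_sub_le {w : ℂ → ℝ≥0∞} {R : ℝ}
    (hw : IsNonnegSuperharmonicOn w (ball 0 R)) {ρ : ℝ} (hρ : 1 < ρ) (hρR : ρ < R) {g : ℂ → ℝ}
    (hg : Integrable fun x => g (expCircle x)) (hg0 : ∀ z, 0 ≤ g z)
    (hwg : ∀ᵐ x, w (expCircle x) = ENNReal.ofReal (g (expCircle x)))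
    {b ε₀ ε₁ : ℝ} {v₀ v₁ : UnitAddCircle → ℝ}
    (hq : ∀ᵐ x, b - g (expCircle x) = v₁ x + v₀ x) (hv₁ : Integrable v₁)
    (hε₁ : ∫ x, |v₁ x| ≤ ε₁) (hε₀ : ∀ᵐ x, |v₀ x| ≤ ε₀) (hε₁0 : 0 ≤ ε₁) (hε₀0 : 0 ≤ ε₀)
    {κ δ r A α : ℝ}
    (hκ : π * ((∫ x, g (expCircle x)) * ((ρ + 1) / (ρ - 1)) / Real.log ρ) ≤ κ)
    (hδ : 0 < δ) (hr : 1 - r = π * δ) (hr0 : 0 < r) (hA : 0 < A)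
    (hAD : (1 - r) / (1 + r) *
      (κ + 4 * π * (ε₀ * (r / (1 - r ^ 2)) + ε₁ * (r / (1 - r) ^ 2))) ≤ A)
    (hα : 0 ≤ α) (hα2 : α < π / 2) :
    ∫⁻ x, ENNReal.ofReal (Real.exp (α / A * |b - g (expCircle x)|)) ≤
      ENNReal.ofReal (2 * Real.exp (α / A * (ε₀ + ε₁ / (2 * δ))) / Real.cos α) := by
  set q : ℂ → ℝ := fun z => b - g z with hqdef
  have hqi : Integrable fun x => q (expCircle x) := (integrable_const b).sub hg
  have hr1 : r < 1 := by nlinarith [mul_pos Real.pi_pos hδ]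
  have hδ2 : 2 * δ ≤ 1 := by nlinarith [Real.pi_gt_three]
  have key : ∀ s ∈ Ioo (0 : ℝ) 1,
      ∫ x, Real.exp (α / A * |poissonAverage s (fun y => q (expCircle y)) x|) ≤
        2 * Real.exp (α / A * (ε₀ + ε₁ / (2 * δ))) / Real.cos α := by
    intro s hs
    have hσ : 1 < s⁻¹ := (one_lt_inv₀ hs.1).2 hs.2
    have hQ := differentiableOn_herglotzIntegral_mul hqi hs.1
    have hre : ∀ x, (herglotzIntegral q (s * expCircle x)).re =
        poissonAverage s (fun y => q (expCircle y)) x := fun x =>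
      re_herglotzIntegral_mul_expCircle hqi hs.1.le hs.2 x
    have h := integral_exp_abs_re_le (Q := fun z => herglotzIntegral q (s * z)) hσ hQ (κ := κ)
      (D := 4 * π * (ε₀ * (r / (1 - r ^ 2)) + ε₁ * (r / (1 - r) ^ 2)))
      (G := ε₀ + ε₁ / (2 * δ)) hδ hr hr0 ?_ ?_ ?_ hA hAD hα hα2
    · simpa only [hre] using h
    · intro z hz
      have hzb : z ∈ ball (0 : ℂ) s⁻¹ := by rwa [mem_ball_zero_iff, hz]
      have h1 := hw.neg_le_re_mul_deriv_herglotzIntegral hρ hρR hg hg0 hwg hs.1 hs.2 hz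
      -- Since `q = b - g`, the lower bound for the radial derivative of the extension of `g`
      -- becomes an upper bound for that of `q`.
      have h2 : deriv (fun z => herglotzIntegral q (s * z)) z =
          -deriv (fun z => herglotzIntegral g (s * z)) z := by
        rw [← deriv_const_sub (b : ℂ)]
        refine Filter.EventuallyEq.deriv_eq ?_
        filter_upwards [isOpen_ball.mem_nhds hzb] with y hy
        exact herglotzIntegral_const_sub hg b (norm_ofReal_mul_lt_one hs.1 hy)
      rw [h2, mul_neg, Complex.neg_re]
      refine le_trans ?_ hκ
      nlinarith [Real.pi_pos]
    · intro z hz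
      exact neg_re_mul_deriv_herglotzIntegral_le hqi hq hv₁ hε₁ hε₀ hε₁0 hε₀0 hr0 hr1 hs.1 hs.2 hz
    · intro x
      simp only [hre]
      refine (abs_integral_poissonAverage_le hs.1.le hs.2 hq hqi hv₁ hε₁ hε₀ hδ hδ2 x).trans
        (le_of_eq ?_)
      field_simp
  obtain ⟨s, hs01, hslim⟩ := exists_seq_tendsto_poissonAverage hqi
  have hcont : Continuous fun a : ℝ => ENNReal.ofReal (Real.exp (α / A * |a|)) :=
    ENNReal.continuous_ofReal.comp (by fun_prop)
  have hpac : ∀ n, Continuous (poissonAverage (s n) fun y => q (expCircle y)) := fun n =>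
    continuous_poissonAverage (hs01 n).1.le (hs01 n).2 hqi
  calc ∫⁻ x, ENNReal.ofReal (Real.exp (α / A * |q (expCircle x)|))
      = ∫⁻ x, liminf (fun n => ENNReal.ofReal (Real.exp (α / A *
          |poissonAverage (s n) (fun y => q (expCircle y)) x|))) atTop := by
        refine lintegral_congr_ae ?_
        filter_upwards [hslim] with x hx
        exact ((hcont.tendsto _).comp hx).liminf_eq.symm
    -- Fatou's lemma; the bound `key` is uniform in the dilation.
    _ ≤ liminf (fun n => ∫⁻ x, ENNReal.ofReal (Real.exp (α / A *
          |poissonAverage (s n) (fun y => q (expCircle y)) x|))) atTop :=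
        lintegral_liminf_le fun n => (hcont.comp (hpac n)).measurable
    _ ≤ _ := by
        refine liminf_le_of_frequently_le' (Frequently.of_forall fun n => ?_)
        rw [← ofReal_integral_eq_lintegral_ofReal]
        · exact ENNReal.ofReal_le_ofReal (key _ (hs01 n))
        · have := hpac n
          exact Continuous.integrable_circle (by fun_prop)
        · exact Eventually.of_forall fun x => (Real.exp_pos _).le

/-! ### Numerical bounds for the constants. -/

section Constants

variable {R R₁ R₂ : ℝ}

/-- In both cases the logarithm in the numerator is at least `log R ≥ log (R / R₁)`, and `(R₁ + R₂)
/ (R₁ - R₂) ≥ 1`. -/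
lemma one_half_le_constB0 (hR₂ : 1 < R₂) (hR₁ : R₂ < R₁) (hR : R₁ < R) :
    1 / 2 ≤ constB0 R R₁ R₂ := by
  have hlog : 0 < Real.log (R / R₁) := Real.log_pos (by rw [lt_div_iff₀] <;> linarith)
  have hlogR : Real.log (R / R₁) ≤ Real.log R := by
    apply Real.log_le_log
    · have : 0 < R := by linarith
      have : 0 < R₁ := by linarith
      positivity
    · exact div_le_self (by linarith) (by linarith)
  have hM : Real.log (R / R₁) ≤
      if R ^ 2 - R₁ ^ 2 > R then Real.log R else Real.log (R ^ 2 / (R ^ 2 - R₁ ^ 2)) := by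
    split_ifs with h
    · exact hlogR
    · refine hlogR.trans (Real.log_le_log (by linarith) ?_)
      rw [le_div_iff₀ (by nlinarith)]
      push Not at h
      nlinarith
  have hq : 1 ≤ (R₁ + R₂) / (R₁ - R₂) := by
    rw [le_div_iff₀ (by linarith)]; linarith
  rw [constB0]
  calc (1 : ℝ) / 2 = 1 / (2 * Real.log (R / R₁)) * 1 * Real.log (R / R₁) := by field_simp
    _ ≤ _ := by gcongr

lemma constB1_nonneg (hR₂ : 1 < R₂) (hR₁ : R₂ < R₁) (hR : R₁ < R) : 0 ≤ constB1 R R₁ R₂ := by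
  have := one_half_le_constB0 hR₂ hR₁ hR
  have : 0 < R₂ ^ 2 - 1 := by nlinarith
  have : 0 < R₂ := by linarith
  rw [constB1]
  exact mul_nonneg (by linarith) (by positivity)

/-- With `s` the inner root, `D = 3r² + 3 - s` and `u = s - 1 - r²`, the expression under the outer
root is `u D / 2`. Elementary bounds on `s` give `D ≤ 3 (r - 1)²` and `u (r + 1)² ≥ 16 r²`; after
squaring, the claim reduces to `27 ≤ 32`. -/
lemma le_constB2_factor {r : ℝ} (hr : 1 < r) :
    8 * π * r / (r - 1) ^ 2 ≤
      16 * π * (r ^ 2 - 1) * √(16 * r ^ 2 - (√(r ^ 4 + 34 * r ^ 2 + 1) - 1 - r ^ 2) ^ 2) /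
        (3 * r ^ 2 + 3 - √(r ^ 4 + 34 * r ^ 2 + 1)) ^ 2 := by
  set s := √(r ^ 4 + 34 * r ^ 2 + 1) with hs
  have hs2 : s ^ 2 = r ^ 4 + 34 * r ^ 2 + 1 := Real.sq_sqrt (by positivity)
  have hr1 : 0 < r - 1 := by linarith
  have hsle : s ≤ r ^ 2 + 4 * r + 1 := by
    apply Real.sqrt_le_iff.2 ⟨by positivity, ?_⟩
    nlinarith [mul_nonneg (by linarith : (0 : ℝ) ≤ r) (sq_nonneg (r - 1))]
  have hles : (16 * r - r ^ 2 - 1) / 3 ≤ s := by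
    apply Real.le_sqrt_of_sq_le
    nlinarith [sq_nonneg ((r + 1) ^ 2)]
  have hlt : s < 3 * r ^ 2 + 3 := by
    rw [hs, Real.sqrt_lt' (by positivity)]
    nlinarith [pow_pos (by nlinarith : 0 < r ^ 2 - 1) 2]
  set D := 3 * r ^ 2 + 3 - s with hD
  set u := s - 1 - r ^ 2 with hu
  have hD0 : 0 < D := by linarith
  have hs0 : 0 ≤ s := Real.sqrt_nonneg _
  have hX : 16 * r ^ 2 - u ^ 2 = u * D / 2 := by
    rw [hu, hD]; linear_combination (-1 / 2 : ℝ) * hs2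
  have huu : u * (s + 1 + r ^ 2) = 32 * r ^ 2 := by
    rw [hu]; linear_combination hs2
  have hu0 : 0 < u := by
    by_contra h
    push Not at h
    nlinarith [mul_nonneg (neg_nonneg.2 h) (by positivity : 0 ≤ s + 1 + r ^ 2)]
  have hule : 16 * r ^ 2 ≤ u * (r + 1) ^ 2 := by nlinarith
  have hDD : D * (3 * r ^ 2 + 3 + s) = 8 * (r ^ 2 - 1) ^ 2 := by
    rw [hD]; linear_combination -hs2
  have hDle : D ≤ 3 * (r - 1) ^ 2 := by
    have h1 : D * (8 / 3 * (r + 1) ^ 2) ≤ 3 * (r - 1) ^ 2 * (8 / 3 * (r + 1) ^ 2) := by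
      calc D * (8 / 3 * (r + 1) ^ 2) ≤ D * (3 * r ^ 2 + 3 + s) := by
            gcongr; linarith
        _ = _ := by rw [hDD]; ring
    exact le_of_mul_le_mul_right h1 (by positivity)
  rw [hX, div_le_div_iff₀ (by positivity) (by positivity)]
  have hkey : r * D ^ 2 / (2 * (r ^ 2 - 1) * (r - 1) ^ 2) ≤ √(u * D / 2) := by
    apply Real.le_sqrt_of_sq_le
    have hrr : 0 < r ^ 2 - 1 := by nlinarith
    rw [div_pow, div_le_iff₀ (by positivity)]
    have h3 : D ^ 3 ≤ 27 * (r - 1) ^ 6 := by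
      calc D ^ 3 ≤ (3 * (r - 1) ^ 2) ^ 3 := by gcongr
        _ = _ := by ring
    calc (r * D ^ 2) ^ 2 = D * (r ^ 2 * D ^ 3) := by ring
      _ ≤ D * (r ^ 2 * (27 * (r - 1) ^ 6)) := by gcongr
      _ ≤ D * (2 * (r - 1) ^ 6 * (16 * r ^ 2)) := by
        have : 0 ≤ r ^ 2 * (r - 1) ^ 6 := by positivity
        refine mul_le_mul_of_nonneg_left ?_ hD0.le
        linarith
      _ ≤ D * (2 * (r - 1) ^ 6 * (u * (r + 1) ^ 2)) := by gcongr
      _ = _ := by ring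
  have hrr : 0 < r ^ 2 - 1 := by nlinarith
  rw [div_le_iff₀ (by positivity)] at hkey
  nlinarith [mul_le_mul_of_nonneg_left hkey (by positivity : 0 ≤ 8 * π)]

lemma le_constB2 (hR₂ : 1 < R₂) (hR₁ : R₂ < R₁) (hR : R₁ < R) :
    4 * π * (R₂ / (R₂ - 1) ^ 2) ≤ constB2 R R₁ R₂ := by
  have h0 := one_half_le_constB0 hR₂ hR₁ hR
  have h1 := le_constB2_factor hR₂
  have : 0 < R₂ - 1 := by linarith
  rw [constB2]
  calc 4 * π * (R₂ / (R₂ - 1) ^ 2) = 1 / 2 * (8 * π * R₂ / (R₂ - 1) ^ 2) := by ring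
    _ ≤ _ := by gcongr

lemma constB3_sq (hR₂ : 1 < R₂) (hR₁ : R₂ < R₁) (hR : R₁ < R) :
    constB3 R R₁ R₂ ^ 2 = 5 * constB2 R R₁ R₂ + 10 * π / Real.log (R / R₁) := by
  have h2 := le_constB2 hR₂ hR₁ hR
  have hlog : 0 < Real.log (R / R₁) := Real.log_pos (by rw [lt_div_iff₀] <;> linarith)
  have : 0 ≤ 4 * π * (R₂ / (R₂ - 1) ^ 2) := by positivity
  have : 0 ≤ constB2 R R₁ R₂ := this.trans h2
  exact Real.sq_sqrt (by positivity)

/-- An intermediate radius for which the constant of the Riesz-type estimate is controlled by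
`constB3`. -/
lemma exists_radius_le_constB3_sq (hR₂ : 1 < R₂) (hR₁ : R₂ < R₁) (hR : R₁ < R) :
    ∃ ρ, 1 < ρ ∧ ρ < R ∧ π * ((ρ + 1) / (ρ - 1) / Real.log ρ) ≤ constB3 R R₁ R₂ ^ 2 / 10 := by
  have hlog : 0 < Real.log (R / R₁) := Real.log_pos (by rw [lt_div_iff₀] <;> linarith)
  -- Write `(ρ + 1) / (ρ - 1) = 1 + 2 / (ρ - 1)`. The bound `ρ ≥ R / R₁` makes the first part match
  -- the `log (R / R₁)` term of `constB3`. For the second, `log ρ ≥ 1 - 1/ρ` leaves `ρ / (ρ - 1)²`,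
  -- which decreases in `ρ`, so `ρ ≥ R₁ > R₂` brings in `constB2`.
  refine ⟨max R₁ (R / R₁), lt_max_of_lt_left (by linarith), max_lt hR ?_, ?_⟩
  · exact div_lt_self (by linarith) (by linarith)
  set ρ := max R₁ (R / R₁) with hρ
  have hρ1 : R₁ ≤ ρ := le_max_left _ _
  have hρ2 : R / R₁ ≤ ρ := le_max_right _ _
  have hlogle : Real.log (R / R₁) ≤ Real.log ρ :=
    Real.log_le_log (div_pos (by linarith) (by linarith)) hρ2
  have hlogρ : 1 - ρ⁻¹ ≤ Real.log ρ := Real.one_sub_inv_le_log_of_pos (by linarith)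
  have hρ0 : 0 < ρ - 1 := by linarith
  have hr0 : 0 < R₂ - 1 := by linarith
  have hpos : 0 < Real.log ρ := hlog.trans_le hlogle
  have hanti : ρ / (ρ - 1) ^ 2 ≤ R₂ / (R₂ - 1) ^ 2 := by
    rw [div_le_div_iff₀ (by positivity) (by positivity)]
    have h1 : 0 ≤ (ρ - R₂) * (ρ * R₂ - 1) := mul_nonneg (by linarith) (by nlinarith)
    nlinarith
  have hinv : 1 / ((ρ - 1) * Real.log ρ) ≤ ρ / (ρ - 1) ^ 2 := by
    have hρp : 0 < ρ := by linarith
    rw [div_le_div_iff₀ (by positivity) (by positivity)]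
    have h1 : ρ - 1 ≤ ρ * Real.log ρ := by
      calc ρ - 1 = ρ * (1 - ρ⁻¹) := by field_simp
        _ ≤ _ := by gcongr
    nlinarith
  have h2 := le_constB2 hR₂ hR₁ hR
  rw [constB3_sq hR₂ hR₁ hR]
  calc π * ((ρ + 1) / (ρ - 1) / Real.log ρ)
      = π / Real.log ρ + 2 * π * (1 / ((ρ - 1) * Real.log ρ)) := by
        field_simp; ring
    _ ≤ π / Real.log (R / R₁) + 2 * π * (R₂ / (R₂ - 1) ^ 2) := by
        refine add_le_add (by gcongr) (mul_le_mul_of_nonneg_left (hinv.trans hanti) (by positivity))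
    _ ≤ π / Real.log (R / R₁) + constB2 R R₁ R₂ / 2 := by linarith
    _ = _ := by ring

/-- The exponents `32π/576` and `17π/576` differ by `15π/576`, which costs a factor at most `1.1`,
while `√2 cos (3π/16) ≥ 1.4 · 0.82 > 1.1`. -/
lemma two_mul_exp_div_cos_le :
    2 * Real.exp (π / 18) / Real.cos (3 * π / 16) ≤
      2 * √2 * Real.exp (π / 4 * (17 / 144)) := by
  have hπ := Real.pi_lt_d4
  have hπ0 := Real.pi_pos
  have hcos : (0.82 : ℝ) ≤ Real.cos (3 * π / 16) := by
    have := Real.one_sub_sq_div_two_le_cos (x := 3 * π / 16)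
    nlinarith
  have hexp : Real.exp (π / 18) ≤ 1.1 * Real.exp (π / 4 * (17 / 144)) := by
    have h1 : Real.exp (-(π * (15 / 576))) ≥ 1 - π * (15 / 576) := by
      have := Real.add_one_le_exp (-(π * (15 / 576)))
      linarith
    have h2 : Real.exp (π / 18) * Real.exp (-(π * (15 / 576))) =
        Real.exp (π / 4 * (17 / 144)) := by
      rw [← Real.exp_add]; congr 1; ring
    have h3 : 1 / 1.1 ≤ Real.exp (-(π * (15 / 576))) := by
      norm_num at h1 ⊢; linarith
    rw [← h2]
    have := Real.exp_pos (π / 18)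
    norm_num at h3 ⊢
    nlinarith
  have hsqrt : (1.4 : ℝ) ≤ √2 := Real.le_sqrt_of_sq_le (by norm_num)
  rw [div_le_iff₀ (by linarith)]
  calc 2 * Real.exp (π / 18) ≤ 2 * (1.1 * Real.exp (π / 4 * (17 / 144))) := by gcongr
    _ ≤ 2 * (1.4 * 0.82) * Real.exp (π / 4 * (17 / 144)) := by
      have := Real.exp_pos (π / 4 * (17 / 144))
      nlinarith
    _ ≤ 2 * (√2 * Real.cos (3 * π / 16)) * Real.exp (π / 4 * (17 / 144)) := by gcongr
    _ = _ := by ring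

/-- The optimal choice of the scale `δ`, with `η = √(ε₁ κ)`. -/
lemma width_le_of_scale {κ ε₀ δ η r : ℝ} (hδ : 0 < δ) (hη : 0 ≤ η) (hε₀ : 0 ≤ ε₀)
    (hκ : κ * δ = η) (hδ2 : 289 * δ ^ 2 ≤ 10) (hr : 1 - r = π * δ) :
    0 < r ∧ (1 - r) / (1 + r) *
      (κ + 4 * π * (ε₀ * (r / (1 - r ^ 2)) + η * δ * (r / (1 - r) ^ 2))) ≤
      3 / 4 * (9 / 2 * ε₀ + 2 * (√10 * η)) := by
  have hπ := Real.pi_lt_d4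
  have hπ0 := Real.pi_pos
  -- `0.1862` is just above `√10 / 17`; it keeps `πδ` below `1`, so that `r > 0`.
  have hδle : δ ≤ 0.1862 := by
    by_contra! h
    nlinarith
  have hπδ : π * δ ≤ 0.59 := by nlinarith
  have hπδ0 : 0 < π * δ := by positivity
  have hr0 : 0 < r := by linarith
  have h1r : 0 < 1 - r := by linarith
  have hsqrt : (3.16 : ℝ) ≤ √10 := Real.le_sqrt_of_sq_le (by norm_num)
  refine ⟨hr0, ?_⟩
  have h1r2 : 1 - r ^ 2 = (1 - r) * (1 + r) := by ring
  have hid : (1 - r) / (1 + r) *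
      (κ + 4 * π * (ε₀ * (r / (1 - r ^ 2)) + η * δ * (r / (1 - r) ^ 2))) =
      π * η * (1 / (1 + r)) + π * ε₀ * (4 * r / (1 + r) ^ 2) + η * (4 * r / (1 + r)) := by
    rw [h1r2, hr, ← hκ]
    field_simp
    ring
  have hb : 4 * r / (1 + r) ^ 2 ≤ 1 := by
    rw [div_le_one (by positivity)]; nlinarith [sq_nonneg (1 - r)]
  have hsum : π * (1 / (1 + r)) + 4 * r / (1 + r) ≤ 4.74 := by
    have : π * (1 / (1 + r)) + 4 * r / (1 + r) = (π + 4 * r) / (1 + r) := by ring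
    rw [this, div_le_iff₀ (by linarith)]
    nlinarith
  rw [hid]
  -- The target has coefficients `3/4 · 9/2 = 3.375 ≥ π` for `ε₀` and `3/4 · 2 · 3.16 = 4.74` for
  -- `η`.
  calc π * η * (1 / (1 + r)) + π * ε₀ * (4 * r / (1 + r) ^ 2) + η * (4 * r / (1 + r))
      = η * (π * (1 / (1 + r)) + 4 * r / (1 + r)) + π * ε₀ * (4 * r / (1 + r) ^ 2) := by ring
    _ ≤ η * 4.74 + π * ε₀ * 1 := by gcongr
    _ ≤ 3 / 4 * (9 / 2 * ε₀ + 2 * (3.16 * η)) := by nlinarith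
    _ ≤ _ := by gcongr

end Constants

/-! ### Choice of parameters and conclusion. -/

/-- The exponential estimate for the real boundary values `v₁ + v₀` of `v - c`. -/
lemma lintegral_exp_abs_add_le {R R₁ R₂ B m c ε₀ ε₁ : ℝ}
    (hR₂ : 1 < R₂) (hR₁ : R₂ < R₁) (hR : R₁ < R)
    {v : ℂ → EReal} (hv : IsSubharmonicOn v (ball 0 R))
    (hB : ∀ z ∈ ball (0 : ℂ) R, v z ≤ (B : EReal)) (hm : v 0 = (m : EReal))
    {v₀ v₁ : UnitAddCircle → ℝ}
    (hmem₁ : MemLp v₁ 1 volume) (hmem₀ : MemLp v₀ ⊤ volume)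
    (hsplit : ∀ᵐ x : UnitAddCircle, v (expCircle x) = ((v₁ x + v₀ x + c : ℝ) : EReal))
    (hv₁ : eLpNorm v₁ 1 volume < ENNReal.ofReal ε₁)
    (hv₀ : eLpNorm v₀ ⊤ volume < ENNReal.ofReal ε₀)
    (hε₁ : 289 * ε₁ ≤ constB3 R R₁ R₂ ^ 2 * (B - m)) :
    ∫⁻ x, ENNReal.ofReal
        (Real.exp (π / 4 * (delta0 R R₁ R₂ B m ε₀ ε₁)⁻¹ * |v₁ x + v₀ x|)) ≤
      ENNReal.ofReal (2 * √2 * Real.exp (π / 4 * (17 / 144))) := by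
  have hε₁0 : 0 < ε₁ := ENNReal.ofReal_pos.1 (pos_of_gt hv₁)
  have hε₀0 : 0 < ε₀ := ENNReal.ofReal_pos.1 (pos_of_gt hv₀)
  have h0 : (0 : ℂ) ∈ ball (0 : ℂ) R := mem_ball_self (by linarith)
  have he : ∀ x, expCircle x ∈ ball (0 : ℂ) R := fun x => by
    simp only [mem_ball, dist_zero_right, norm_expCircle]; linarith
  have hmB : m ≤ B := by
    have := hB 0 h0
    rw [hm] at this
    exact_mod_cast this
  set w := superharmonicGap v B (ball 0 R) with hw_def
  have hw : IsNonnegSuperharmonicOn w (ball 0 R) :=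
    isNonnegSuperharmonicOn_superharmonicGap isOpen_ball hv hB
  have hw0 : w 0 = ENNReal.ofReal (B - m) := by
    rw [hw_def, superharmonicGap, indicator_of_mem h0, hm, ← EReal.coe_sub,
      EReal.toENNReal_of_ne_top (EReal.coe_ne_top _), EReal.toReal_coe]
  have hwe : ∀ᵐ x, w (expCircle x) = ENNReal.ofReal (B - (v₁ x + v₀ x + c)) ∧
      0 ≤ B - (v₁ x + v₀ x + c) := by
    filter_upwards [hsplit] with x hx
    refine ⟨?_, ?_⟩
    · rw [hw_def, superharmonicGap, indicator_of_mem (he x), hx, ← EReal.coe_sub,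
        EReal.toENNReal_of_ne_top (EReal.coe_ne_top _), EReal.toReal_coe]
    · have := hB _ (he x)
      rw [hx] at this
      have : v₁ x + v₀ x + c ≤ B := by exact_mod_cast this
      linarith
  set g : ℂ → ℝ := fun z => (w z).toReal with hg_def
  have hge : ∀ᵐ x, g (expCircle x) = B - (v₁ x + v₀ x + c) := by
    filter_upwards [hwe] with x hx
    simp only [hg_def]
    rw [hx.1, ENNReal.toReal_ofReal hx.2]
  have hi₁ : Integrable v₁ := memLp_one_iff_integrable.1 hmem₁
  have hi₀ : Integrable v₀ := hmem₀.integrable le_top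
  have hgi : Integrable fun x => g (expCircle x) :=
    ((integrable_const B).sub ((hi₁.add hi₀).add (integrable_const c))).congr
      (by filter_upwards [hge] with x hx; rw [hx]; rfl)
  have hwg : ∀ᵐ x, w (expCircle x) = ENNReal.ofReal (g (expCircle x)) := by
    filter_upwards [hwe, hge] with x hx hx'
    rw [hx.1, hx']
  -- The super-mean value property of `w` at `0` with radius `1`.
  have hgm : ∫ x, g (expCircle x) ≤ B - m := by
    have h1 := hw.lintegral_le 0 1 one_pos (closedBall_subset_ball (by linarith))
    simp only [Complex.ofReal_one, one_mul, zero_add] at h1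
    rw [hw0, lintegral_congr_ae hwg, ← ofReal_integral_eq_lintegral_ofReal hgi
      (Eventually.of_forall fun _ => ENNReal.toReal_nonneg)] at h1
    exact (ENNReal.ofReal_le_ofReal_iff (by linarith)).1 h1
  have hn₁ : ∫ x, |v₁ x| ≤ ε₁ := by
    rw [eLpNorm_one_eq_lintegral_enorm, ← ofReal_integral_norm_eq_lintegral_enorm hi₁] at hv₁
    exact ((ENNReal.ofReal_lt_ofReal_iff hε₁0).1 hv₁).le
  have hn₀ : ∀ᵐ x, |v₀ x| ≤ ε₀ := by
    rw [eLpNorm_exponent_top] at hv₀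
    filter_upwards [ae_le_eLpNormEssSup (f := v₀) (μ := volume)] with x hx
    have := hx.trans hv₀.le
    rw [← ofReal_norm] at this
    exact (ENNReal.ofReal_le_ofReal_iff hε₀0.le).1 this
  have hq : ∀ᵐ x, B - c - g (expCircle x) = v₁ x + v₀ x := by
    filter_upwards [hge] with x hx
    rw [hx]; ring
  obtain ⟨ρ, hρ, hρR, hρB⟩ := exists_radius_le_constB3_sq hR₂ hR₁ hR
  set b := constB3 R R₁ R₂ with hb
  have hb0 : 0 ≤ b := Real.sqrt_nonneg _
  -- The factor `1/10` is the one from the choice of `ρ`; with it the smallness hypothesis on `ε₁`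
  -- reads `289 δ² ≤ 10`.
  set κ := b ^ 2 * (B - m) / 10 with hκ
  have hκε : 289 * ε₁ ≤ 10 * κ := by rw [hκ]; linarith
  have hκ0 : 0 < κ := by linarith
  have hgκ : π * ((∫ x, g (expCircle x)) * ((ρ + 1) / (ρ - 1)) / Real.log ρ) ≤ κ := by
    have hlog : 0 < Real.log ρ := Real.log_pos hρ
    have hρ1 : 0 < ρ - 1 := by linarith
    have hpos : 0 ≤ π * ((ρ + 1) / (ρ - 1) / Real.log ρ) := by positivity
    calc π * ((∫ x, g (expCircle x)) * ((ρ + 1) / (ρ - 1)) / Real.log ρ)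
        = (∫ x, g (expCircle x)) * (π * ((ρ + 1) / (ρ - 1) / Real.log ρ)) := by ring
      _ ≤ (B - m) * (b ^ 2 / 10) :=
        mul_le_mul hgm hρB hpos (by linarith)
      _ = κ := by rw [hκ]; ring
  -- This scale balances `κ δ` against `ε₁ / δ`: both equal `η = √(ε₁ κ)`, and `√10 η` is the term
  -- `B₃ √(ε₁ (B - m))` of `delta0`.
  set δ := √(ε₁ / κ) with hδ_def
  have hδ : 0 < δ := Real.sqrt_pos.2 (by positivity)
  have hδ2 : δ ^ 2 = ε₁ / κ := Real.sq_sqrt (by positivity)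
  set η := κ * δ with hη
  have hηδ : η * δ = ε₁ := by
    rw [hη, mul_assoc, ← sq, hδ2]; field_simp
  have hη0 : 0 < η := by positivity
  have hδle : 289 * δ ^ 2 ≤ 10 := by
    rw [hδ2, ← mul_div_assoc, div_le_iff₀ hκ0]; exact hκε
  have hδ₀ : delta0 R R₁ R₂ B m ε₀ ε₁ = 9 / 2 * ε₀ + 2 * (√10 * η) := by
    have h1 : b * √(ε₁ * (B - m)) = √10 * η := by
      rw [← pow_left_inj₀ (by positivity) (by positivity) two_ne_zero, mul_pow, mul_pow,
        Real.sq_sqrt (mul_nonneg hε₁0.le (by linarith)), Real.sq_sqrt (by norm_num), hη, mul_pow,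
        hδ2]
      field_simp
      rw [hκ]; ring
    rw [delta0, ← hb, mul_assoc, h1]
  obtain ⟨hr0, hA⟩ := width_le_of_scale (r := 1 - π * δ) hδ hη0.le hε₀0.le hη.symm hδle
    (by ring)
  rw [← hδ₀, hηδ] at hA
  set d := delta0 R R₁ R₂ B m ε₀ ε₁ with hd
  have hsqrt : (3 : ℝ) ≤ √10 := Real.le_sqrt_of_sq_le (by norm_num)
  have hd0 : 0 < d := by rw [hδ₀]; positivity
  -- The width bound is `A = 3d/4`, so `α = 3π/16 < π/2` yields exactly the exponent `π / (4d)`.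
  have hα : 3 * π / 16 / (3 / 4 * d) = π / 4 * d⁻¹ := by field_simp; norm_num
  have key := hw.lintegral_exp_abs_sub_le hρ hρR hgi (fun _ => ENNReal.toReal_nonneg) hwg hq hi₁
    hn₁ hn₀ hε₁0.le hε₀0.le hgκ hδ (sub_sub_cancel 1 (π * δ)) hr0 (by positivity) hA
    (α := 3 * π / 16) (by positivity) (by linarith [Real.pi_pos])
  rw [hα] at key
  have hcos : 0 < Real.cos (3 * π / 16) :=
    Real.cos_pos_of_mem_Ioo ⟨by linarith [Real.pi_pos], by linarith [Real.pi_pos]⟩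
  -- Arc averages are at most `ε₀ + η/2`, which is below `2d/9` because `√10 ≥ 3`.
  have hG : π / 4 * d⁻¹ * (ε₀ + ε₁ / (2 * δ)) ≤ π / 18 := by
    have h1 : ε₁ / (2 * δ) = η / 2 := by rw [← hηδ]; field_simp
    have h2 : ε₀ + η / 2 ≤ 2 / 9 * d := by rw [hδ₀]; nlinarith
    calc π / 4 * d⁻¹ * (ε₀ + ε₁ / (2 * δ)) ≤ π / 4 * d⁻¹ * (2 / 9 * d) := by
          rw [h1]; gcongr
      _ = π / 18 := by field_simp; norm_num
  calc ∫⁻ x, ENNReal.ofReal (Real.exp (π / 4 * d⁻¹ * |v₁ x + v₀ x|))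
      = ∫⁻ x, ENNReal.ofReal (Real.exp (π / 4 * d⁻¹ * |B - c - g (expCircle x)|)) :=
        lintegral_congr_ae (by filter_upwards [hq] with x hx; rw [hx])
    _ ≤ _ := key
    _ ≤ _ := ENNReal.ofReal_le_ofReal (le_trans (by gcongr) two_mul_exp_div_cos_le)

lemma delta0_pos {R R₁ R₂ B m ε₀ ε₁ : ℝ} (hε₀ : 0 < ε₀) : 0 < delta0 R R₁ R₂ B m ε₀ ε₁ := by
  have : 0 ≤ constB3 R R₁ R₂ := Real.sqrt_nonneg _
  rw [delta0]
  positivity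

end SubharmonicSplitting

theorem mainTheorem6 (R R₁ R₂ B m c ε₀ ε₁ : ℝ)
    (hR₂ : 1 < R₂) (hR₁ : R₂ < R₁) (hR : R₁ < R)
    (v : ℂ → EReal) (hv : IsSubharmonicOn v (Metric.ball 0 R))
    (hB : ∀ z ∈ Metric.ball (0 : ℂ) R, v z ≤ (B : EReal)) (hm : v 0 = (m : EReal))
    (v₀ v₁ : UnitAddCircle → ℝ)
    (hmem₁ : MemLp v₁ 1 volume) (hmem₀ : MemLp v₀ ⊤ volume)
    (hsplit : ∀ᵐ x : UnitAddCircle, v (expCircle x) = ((v₁ x + v₀ x + c : ℝ) : EReal))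
    (hv₁ : eLpNorm v₁ 1 volume < ENNReal.ofReal ε₁)
    (hv₀ : eLpNorm v₀ ⊤ volume < ENNReal.ofReal ε₀)
    (hε₁ : 289 * ε₁ ≤ constB3 R R₁ R₂ ^ 2 * (B - m)) :
    (∫⁻ x : UnitAddCircle,
        EReal.exp (((Real.pi / 4 * (delta0 R R₁ R₂ B m ε₀ ε₁)⁻¹ : ℝ) : EReal) *
          ((v (expCircle x) - (c : EReal)).abs : EReal))
      ≤ ENNReal.ofReal (constC0 R R₁ R₂)) ∧
    (∀ ε₂ : ℝ, 0 < ε₂ →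
      volume {x : UnitAddCircle | ENNReal.ofReal ε₂ < (v (expCircle x) - (c : EReal)).abs}
        ≤ ENNReal.ofReal (2 * √2 *
            Real.exp (Real.pi / 4 *
              (17 / 144 + constB1 R R₁ R₂ / (16 * constB3 R R₁ R₂ ^ 2)
                - ε₂ * (delta0 R R₁ R₂ B m ε₀ ε₁)⁻¹)))) := by
  have hε₀ : 0 < ε₀ := ENNReal.ofReal_pos.1 (pos_of_gt hv₀)
  have hd := SubharmonicSplitting.delta0_pos (R := R) (R₁ := R₁) (R₂ := R₂) (B := B) (m := m)
    (ε₁ := ε₁) hε₀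
  have hexp := SubharmonicSplitting.lintegral_exp_abs_add_le hR₂ hR₁ hR hv hB hm hmem₁ hmem₀
    hsplit hv₁ hv₀ hε₁
  have hB₁ := SubharmonicSplitting.constB1_nonneg hR₂ hR₁ hR
  have hq : 0 ≤ constB1 R R₁ R₂ / (16 * constB3 R R₁ R₂ ^ 2) := by positivity
  set q := constB1 R R₁ R₂ / (16 * constB3 R R₁ R₂ ^ 2)
  set d := delta0 R R₁ R₂ B m ε₀ ε₁
  have hπ := Real.pi_pos
  have habs : ∀ᵐ x : UnitAddCircle,
      (v (expCircle x) - (c : EReal)).abs = ENNReal.ofReal |v₁ x + v₀ x| := by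
    filter_upwards [hsplit] with x hx
    rw [hx, ← EReal.coe_sub, add_sub_cancel_right]
    rfl
  refine ⟨?_, fun ε₂ hε₂ => ?_⟩
  · calc ∫⁻ x : UnitAddCircle, EReal.exp (((Real.pi / 4 * d⁻¹ : ℝ) : EReal) *
          ((v (expCircle x) - (c : EReal)).abs : EReal))
        = ∫⁻ x, ENNReal.ofReal (Real.exp (Real.pi / 4 * d⁻¹ * |v₁ x + v₀ x|)) := by
          refine lintegral_congr_ae ?_
          filter_upwards [habs] with x hx
          rw [hx, EReal.coe_ennreal_ofReal, max_eq_left (abs_nonneg _), ← EReal.coe_mul,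
            EReal.exp_coe]
      _ ≤ _ := hexp
      _ ≤ _ := by
          rw [constC0]
          -- The bound obtained has `π/4` in place of `π` and no `constB1` term; both changes only
          -- enlarge the right side.
          refine ENNReal.ofReal_le_ofReal ?_
          gcongr
          · linarith
          · exact le_add_of_nonneg_right hq
  · have hE : 0 < Real.exp (Real.pi / 4 * d⁻¹ * ε₂) := Real.exp_pos _
    calc volume {x : UnitAddCircle | ENNReal.ofReal ε₂ < (v (expCircle x) - (c : EReal)).abs}
        ≤ volume {x : UnitAddCircle | ENNReal.ofReal (Real.exp (Real.pi / 4 * d⁻¹ * ε₂)) ≤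
            ENNReal.ofReal (Real.exp (Real.pi / 4 * d⁻¹ * |v₁ x + v₀ x|))} := by
          refine measure_mono_ae ?_
          filter_upwards [habs] with x hx
          intro (h : ENNReal.ofReal ε₂ < (v (expCircle x) - (c : EReal)).abs)
          rw [hx] at h
          have h' := (ENNReal.lt_ofReal_iff_toReal_lt ENNReal.ofReal_ne_top).1 h
          rw [ENNReal.toReal_ofReal hε₂.le] at h'
          show ENNReal.ofReal _ ≤ ENNReal.ofReal _
          gcongr
      _ ≤ (∫⁻ x, ENNReal.ofReal (Real.exp (Real.pi / 4 * d⁻¹ * |v₁ x + v₀ x|))) /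
            ENNReal.ofReal (Real.exp (Real.pi / 4 * d⁻¹ * ε₂)) := by
          -- Markov's inequality for the exponential.
          refine meas_ge_le_lintegral_div ?_ (by simpa using hE) ENNReal.ofReal_ne_top
          have := hmem₁.aestronglyMeasurable.aemeasurable
          have := hmem₀.aestronglyMeasurable.aemeasurable
          fun_prop
      _ ≤ ENNReal.ofReal (2 * √2 * Real.exp (Real.pi / 4 * (17 / 144))) /
            ENNReal.ofReal (Real.exp (Real.pi / 4 * d⁻¹ * ε₂)) := by gcongr
      _ ≤ _ := by
          rw [← ENNReal.ofReal_div_of_pos hE, mul_div_assoc, ← Real.exp_sub]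
          refine ENNReal.ofReal_le_ofReal ?_
          gcongr
          have : 0 ≤ Real.pi / 4 * q := by positivity
          linarith
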